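/- Let $M$ be a smooth (Hausdorff, finite-dimensional, boundaryless) manifold and let $X$ be a smooth complete vector field on $M$ with flow $\mathrm{Fl}_X^t$. Suppose that the flow is periodic: there is a smooth positive function $T:M\to\mathbb R$ with $\mathrm{Fl}_X^{t+T(m)}(m)=\mathrm{Fl}_X^t(m)$ for all $m\in M$, $t\in\mathbb R$. Let $\omega=2\pi/T$ be the frequency function and let $\Upsilon=\frac1\omega X$, whose flow is $2\pi$-periodic and defines an $\mathbb S^1$-action on $M$. For a multivector field $A$ put $$\mathcal L_XA=\frac{d}{dt}\Big|_{t=0}(\mathrm{Fl}_X^t)^*A,\qquad \langle A\rangle=\frac1{2\pi}\int_0^{2\pi}(\mathrm{Fl}_\Upsilon^t)^*A\,dt,\qquad \mathcal S(A)=\frac1{2\pi}\int_0^{2\pi}(t-\pi)(\mathrm{Fl}_\Upsilon^t)^*A\,dt,$$ and call $A$ $\mathbb S^1$-invariant if $(\mathrm{Fl}_\Upsilon^t)^*A=A$ for all $t\in\mathbb R$. For a 1-form $\alpha$ and a $k$-vector field $A$, let $(\mathbf i_\alpha A)(\alpha_1,\dots,\alpha_{k-1})=A(\alpha,\alpha_1,\dots,\alpha_{k-1})$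 if $k\ge 1$, and $\mathbf i_\alpha A=0$ if $k=0$ (so that terms $X\wedge\mathbf i_{d\omega}(\cdot)$ and $X\wedge\mathcal S^2(\mathbf i_{d\omega}(\cdot))$ vanish for $k=0$). The exterior product is normalized so that $(X\wedge Y)(\alpha,\beta)=\alpha(X)\beta(Y)-\beta(X)\alpha(Y)$ for vector fields $X,Y$. Theorem 3.1. Let $k\ge 0$ and let $B$ be a smooth $k$-vector field on $M$. Then a pair $(A,\bar B)$ of sections of $\wedge^kTM$ consists of smooth $k$-vector fields satisfying $$\mathcal L_XA=B-\bar B,\qquad \bar B\ \text{ is } \mathbb S^1\text{-invariant},$$ if and only if there is a smooth $\mathbb S^1$-invariant $k$-vector field $C$ on $M$ such that $$\bar B=\langle B\rangle+\frac1\omega\,X\wedge\mathbf i_{d\omega}C,\qquad A=\frac1\omega\,\mathcal S(B)+\frac1{\omega^3}\,X\wedge\mathcal S^2(\mathbf i_{d\omega}B)+C.$$ -/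

import Mathlib

open scoped Manifold ContDiff

noncomputable section

namespace PeriodicFlow

/-! ### Linear algebra of multivectors -/

/-- The `k`-vectors of a finite-dimensional real vector space `V`, viewed, as tensors of type
`(k, 0)`, as the alternating `k`-linear forms on the dual space of `V`. -/
abbrev Multivector (V : Type*) [NormedAddCommGroup V] [NormedSpace ℝ V] (k : ℕ) : Type _ :=
  (V →L[ℝ] ℝ) [⋀^Fin k]→L[ℝ] ℝ

section Linear

variable {V W : Type*} [NormedAddCommGroup V] [NormedSpace ℝ V]
  [NormedAddCommGroup W] [NormedSpace ℝ W]

/-- The push-forward `∧ᵏ L` of `k`-vectors under a linear map `L`: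
`(L_* a)(α₁, …, α_k) = a(α₁ ∘ L, …, α_k ∘ L)`. -/
def Multivector.map {k : ℕ} (L : V →L[ℝ] W) (a : Multivector V k) : Multivector W k :=
  a.compContinuousLinearMap (L.precomp ℝ)

/-- The interior product `(i_α a)(α₁, …, α_{k-1}) = a(α, α₁, …, α_{k-1})`, with `i_α a = 0` for
every `0`-vector `a`. -/
def Multivector.interior (α : V →L[ℝ] ℝ) : {k : ℕ} → Multivector V k → Multivector V (k - 1)
  | 0, _ => 0
  | _ + 1, a => a.curryLeft α

/-- The exterior product `v ∧ d` of a vector and a `k`-vector: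
`(v ∧ d)(α₀, …, α_k) = ∑ i, (-1)^i α_i(v) d(α₀, …, α_{i-1}, α_{i+1}, …, α_k)`. -/
def Multivector.wedge {k : ℕ} (v : V) (d : Multivector V k) : Multivector V (k + 1) :=
  ContinuousAlternatingMap.alternatizeUncurryFin
    ((ContinuousLinearMap.apply ℝ ℝ v).smulRight d)

/-- The exterior product `v ∧ d` of a vector and a `(k - 1)`-vector, as a `k`-vector. For `k = 0`
there is no nonzero vector of degree `-1` and the product is zero. -/
def Multivector.wedgePred (v : V) : {k : ℕ} → Multivector V (k - 1) → Multivector V k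
  | 0, _ => 0
  | _ + 1, d => Multivector.wedge v d

end Linear

/-! ### Multivector fields on a manifold modelled on the finite-dimensional space `E` -/

variable {E : Type*} [NormedAddCommGroup E] [NormedSpace ℝ E]
  {M : Type*} [TopologicalSpace M] [ChartedSpace E M]

/-- A vector field is smooth if it is a smooth section of the tangent bundle. -/
def IsSmoothVectorField [IsManifold 𝓘(ℝ, E) ∞ M] (X : ∀ m : M, TangentSpace 𝓘(ℝ, E) m) : Prop :=
  ContMDiff 𝓘(ℝ, E) 𝓘(ℝ, E).tangent ∞
    (fun m => (⟨m, X m⟩ : TangentBundle 𝓘(ℝ, E) M))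

/-- A vector field is complete if through every point there passes an integral curve that is
defined for all times. -/
def IsCompleteVectorField (X : ∀ m : M, TangentSpace 𝓘(ℝ, E) m) : Prop :=
  ∀ m : M, ∃ γ : ℝ → M, γ 0 = m ∧ IsMIntegralCurve (I := 𝓘(ℝ, E)) γ X

open Classical in
/-- The flow `Fl_X^t` of a complete vector field: `t ↦ flow X t m` is the integral curve of `X`
starting at `m`. (It is unique if `X` is smooth and `M` is Hausdorff.) -/
def flow (X : ∀ m : M, TangentSpace 𝓘(ℝ, E) m) (t : ℝ) (m : M) : M :=
  if h : ∃ γ : ℝ → M, γ 0 = m ∧ IsMIntegralCurve (I := 𝓘(ℝ, E)) γ X then h.choose t else m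

variable (E M) in
/-- Sections of `∧ᵏ TM`, not assumed to be smooth. The value at `m` is a `k`-vector of the tangent
space at `m`, which in Mathlib is `E` by definition (it is identified with `E` through the
preferred chart at `m`). -/
abbrev MultivectorSection (k : ℕ) : Type _ := M → Multivector E k

/-- The section `A` of `∧ᵏ TM` is smooth, i.e. a `k`-vector field: in every chart of the preferred
atlas its coordinate expression is a smooth map. -/
def IsSmoothMultivector {k : ℕ} (A : MultivectorSection E M k) : Prop :=
  ∀ x : M, ContMDiffOn 𝓘(ℝ, E) 𝓘(ℝ, Multivector E k) ∞
    (fun m => Multivector.map (V := E) (W := E)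
      (mfderiv 𝓘(ℝ, E) 𝓘(ℝ, E) (extChartAt 𝓘(ℝ, E) x) m) (A m))
    (chartAt E x).source

/-- The pull-back of a section `A` of `∧ᵏ TM` by a diffeomorphism `f`:
`(f^* A)(m) = (T_m f)⁻¹_* A(f m)`. -/
def pullback {k : ℕ} (f : M → M) (A : MultivectorSection E M k) : MultivectorSection E M k :=
  fun m => Multivector.map (V := E) (W := E) (mfderiv 𝓘(ℝ, E) 𝓘(ℝ, E) f m).inverse (A (f m))

/-- The Lie derivative `L_X A = d/dt|_{t = 0} (Fl_X^t)^* A` along a complete vector field. -/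
def lieDerivative {k : ℕ} (X : ∀ m : M, TangentSpace 𝓘(ℝ, E) m) (A : MultivectorSection E M k) :
    MultivectorSection E M k :=
  fun m => deriv (fun t : ℝ => pullback (flow X t) A m) 0

/-- The average `⟨A⟩ = (1 / 2π) ∫₀^{2π} (Fl_Υ^t)^* A dt`, for `Υ` with `2π`-periodic flow. -/
def average {k : ℕ} (Υ : ∀ m : M, TangentSpace 𝓘(ℝ, E) m) (A : MultivectorSection E M k) :
    MultivectorSection E M k :=
  fun m => (1 / (2 * Real.pi)) • ∫ t in (0 : ℝ)..(2 * Real.pi), pullback (flow Υ t) A m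

/-- The operator `S(A) = (1 / 2π) ∫₀^{2π} (t - π) (Fl_Υ^t)^* A dt`, for `Υ` with `2π`-periodic
flow. -/
def opS {k : ℕ} (Υ : ∀ m : M, TangentSpace 𝓘(ℝ, E) m) (A : MultivectorSection E M k) :
    MultivectorSection E M k :=
  fun m => (1 / (2 * Real.pi)) •
    ∫ t in (0 : ℝ)..(2 * Real.pi), (t - Real.pi) • pullback (flow Υ t) A m

/-- `A` is invariant under the circle action with infinitesimal generator `Υ`. -/
def IsInvariant {k : ℕ} (Υ : ∀ m : M, TangentSpace 𝓘(ℝ, E) m) (A : MultivectorSection E M k) :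
    Prop :=
  ∀ t : ℝ, pullback (flow Υ t) A = A

/-- `i_{df} A` for a smooth function `f` and a section `A` of `∧ᵏ TM`. -/
def interiorD {k : ℕ} (f : M → ℝ) (A : MultivectorSection E M k) :
    MultivectorSection E M (k - 1) :=
  fun m => Multivector.interior (V := E) (mfderiv 𝓘(ℝ, E) 𝓘(ℝ, ℝ) f m) (A m)

/-- `X ∧ D` for a section `D` of `∧ᵏ⁻¹ TM` (zero if `k = 0`). -/
def wedgeX {k : ℕ} (X : ∀ m : M, TangentSpace 𝓘(ℝ, E) m) (D : MultivectorSection E M (k - 1)) :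
    MultivectorSection E M k :=
  fun m => Multivector.wedgePred (V := E) (X m) (D m)

/-- `T` is a period function of the flow of `X`: smooth, positive, and
`Fl_X^{t + T(m)}(m) = Fl_X^t(m)`. -/
structure IsPeriodFunction (X : ∀ m : M, TangentSpace 𝓘(ℝ, E) m) (T : M → ℝ) : Prop where
  smooth : ContMDiff 𝓘(ℝ, E) 𝓘(ℝ, ℝ) ∞ T
  pos : ∀ m, 0 < T m
  periodic : ∀ (m : M) (t : ℝ), flow X (t + T m) m = flow X t m

/-- The frequency function `ω = 2π / T`. -/
def frequency (T : M → ℝ) : M → ℝ := fun m => 2 * Real.pi / T m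

/-- The vector field `Υ = (1 / ω) X`. -/
def generator (X : ∀ m : M, TangentSpace 𝓘(ℝ, E) m) (freq : M → ℝ) :
    ∀ m : M, TangentSpace 𝓘(ℝ, E) m :=
  fun m => (1 / freq m) • X m

end PeriodicFlow

end

noncomputable section

set_option maxSynthPendingDepth 3

namespace PeriodicFlow

open Set Filter Topology MeasureTheory Bundle

/-! ### Linear algebra of multivectors -/

namespace Multivector

variable {U V W : Type*} [NormedAddCommGroup U] [NormedSpace ℝ U]
  [NormedAddCommGroup V] [NormedSpace ℝ V] [NormedAddCommGroup W] [NormedSpace ℝ W]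

/-! Write Q(A) = Υ ∧ i_{dω}A. A period function is constant along orbits
(`IsPeriodFunction.apply_flow`), so dω(Υ) = 0 and Fl_X^t(m) = Fl_Υ^{ω(m)t}(m). Differentiating this
in m gives T Fl_X^t = T Fl_Υ^{ωt} ∘ (id + t Υ ⊗ dω). The inverse shear id - t Υ ⊗ dω acts on
multivectors as id - tQ (`Multivector.map_shear`). Hence 𝓛_X = ω 𝓛_Υ - Q
(`IsCircleGenerator.lieDerivative_reparam`), and the problem concerns only the circle action.

The operator S inverts 𝓛_Υ up to the average: 𝓛_Υ S(B) = B - ⟨B⟩ and ⟨S(B)⟩ = 0. Since Q² = 0 and Q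
commutes with S and 𝓛_Υ, the field A₀ = ω⁻¹ S(B) + ω⁻² Q S²(B) satisfies 𝓛_X A₀ = B - ⟨B⟩: the term
-ω⁻¹ Q S(B) produced by the first summand cancels against 𝓛_Υ of the second.

For an arbitrary solution put C = A - A₀. Then ω 𝓛_Υ C - Q(C) is invariant. Contracting with dω
kills Q(C), so 𝓛_Υ(i_{dω}C) is invariant. A periodic curve cannot have a nonzero constant
derivative, so i_{dω}C is invariant, hence so are Q(C) and 𝓛_Υ C, and by the same argument C is
invariant. What remains of the equation determines the invariant part of B.

The analytic input is joint smoothness of the flow (`contMDiff_flow`), obtained from the implicit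
function theorem on a space of curves, together with smoothness of parameter integrals. -/

theorem map_apply {k : ℕ} (L : V →L[ℝ] W) (a : Multivector V k) (β : Fin k → W →L[ℝ] ℝ) :
    map L a β = a fun i => (β i).comp L := rfl

theorem map_comp {k : ℕ} (L : V →L[ℝ] W) (K : U →L[ℝ] V) (a : Multivector U k) :
    map L (map K a) = map (L.comp K) a := rfl

@[simp]
theorem map_id {k : ℕ} (a : Multivector V k) : map (ContinuousLinearMap.id ℝ V) a = a := rfl

/-- The push-forward of `k`-vectors under a fixed linear map, as a continuous linear map. -/
def mapCLM {k : ℕ} (L : V →L[ℝ] W) : Multivector V k →L[ℝ] Multivector W k :=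
  ContinuousAlternatingMap.compContinuousLinearMapCLM (L.precomp ℝ)

@[simp]
theorem mapCLM_apply {k : ℕ} (L : V →L[ℝ] W) (a : Multivector V k) : mapCLM L a = map L a := rfl

/-- The interior product with a fixed covector, as a linear map. -/
def interiorL {k : ℕ} (α : V →L[ℝ] ℝ) : Multivector V k →ₗ[ℝ] Multivector V (k - 1) where
  toFun := interior α
  map_add' a b := by cases k <;> simp [interior]
  map_smul' c a := by cases k <;> simp [interior]

@[simp]
theorem interiorL_apply {k : ℕ} (α : V →L[ℝ] ℝ) (a : Multivector V k) :
    interiorL α a = interior α a := rfl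

/-- The interior product as a continuous bilinear map, in positive degree. -/
def interiorSuccCLM (k : ℕ) :
    Multivector V (k + 1) →L[ℝ] (V →L[ℝ] ℝ) →L[ℝ] Multivector V k :=
  LinearMap.mkContinuous
    { toFun := fun a => a.curryLeft
      map_add' := fun a b => by ext; simp
      map_smul' := fun c a => by ext; simp } 1
    fun a => by simp

theorem interior_succ {k : ℕ} (α : V →L[ℝ] ℝ) (a : Multivector V (k + 1)) :
    interior α a = interiorSuccCLM k a α := rfl

theorem wedge_apply {k : ℕ} (v : V) (d : Multivector V k) (β : Fin (k + 1) → V →L[ℝ] ℝ) :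
    wedge v d β = ∑ i : Fin (k + 1), (-1 : ℤ) ^ (i : ℕ) • (β i v * d (i.removeNth β)) := by
  simp [wedge, ContinuousAlternatingMap.alternatizeUncurryFin_apply]

/-- The exterior product with a vector as a continuous bilinear map. -/
def wedgeCLM (k : ℕ) : V →L[ℝ] Multivector V k →L[ℝ] Multivector V (k + 1) :=
  ((ContinuousLinearMap.compL ℝ _ _ _
      (ContinuousAlternatingMap.alternatizeUncurryFinCLM ℝ (V →L[ℝ] ℝ) ℝ)).comp
    (ContinuousLinearMap.smulRightL ℝ (V →L[ℝ] ℝ) (Multivector V k))).comp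
    (ContinuousLinearMap.apply ℝ ℝ)

/-- The exterior product with a fixed vector, as a linear map. -/
def wedgePredL {k : ℕ} (v : V) : Multivector V (k - 1) →ₗ[ℝ] Multivector V k where
  toFun := wedgePred v
  map_add' a b := by
    cases k with
    | zero => simp [wedgePred]
    | succ k => exact (wedgeCLM k v).map_add a b
  map_smul' c a := by
    cases k with
    | zero => simp [wedgePred]
    | succ k => exact (wedgeCLM k v).map_smul c a

@[simp]
theorem wedgePredL_apply {k : ℕ} (v : V) (d : Multivector V (k - 1)) :
    wedgePredL v d = wedgePred v d := rfl

theorem smul_wedgePred {k : ℕ} (c : ℝ) (v : V) (d : Multivector V (k - 1)) :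
    wedgePred (c • v) d = c • wedgePred v d := by
  cases k with
  | zero => simp [wedgePred]
  | succ k =>
    change wedgeCLM k (c • v) d = c • wedgeCLM k v d
    simp

theorem map_interior {k : ℕ} (L : V →L[ℝ] W) (α : W →L[ℝ] ℝ) (a : Multivector V k) :
    map L (interior (α.comp L) a) = interior α (map L a) := by
  cases k with
  | zero => rfl
  | succ k =>
    ext β
    simp only [interior, map_apply, ContinuousAlternatingMap.curryLeft_apply_apply]
    congr 1
    ext i
    refine Fin.cases ?_ (fun j => ?_) i <;> simp

theorem map_wedgePred {k : ℕ} (L : V →L[ℝ] W) (v : V) (d : Multivector V (k - 1)) :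
    map L (wedgePred v d) = wedgePred (k := k) (L v) (map L d) := by
  cases k with
  | zero => rfl
  | succ k =>
    ext β
    simp only [wedgePred, map_apply, wedge_apply]
    rfl

theorem interior_interior {k : ℕ} (α : V →L[ℝ] ℝ) (a : Multivector V k) :
    interior α (interior α a) = 0 := by
  match k, a with
  | 0, _ => rfl
  | 1, _ => rfl
  | k + 2, a => exact ContinuousAlternatingMap.curryLeft_same a α

theorem interior_comm {k : ℕ} (α β : V →L[ℝ] ℝ) (a : Multivector V (k + 2)) :
    interior α (interior β a) = -interior β (interior α a) := by
  have h := interior_interior (α + β) a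
  have hα := interior_interior α a
  have hβ := interior_interior β a
  have e : ∀ γ δ : V →L[ℝ] ℝ, interior γ (interior δ a) =
      interiorSuccCLM k (interiorSuccCLM (k + 1) a δ) γ := fun _ _ => rfl
  simp only [e] at h hα hβ ⊢
  simp only [map_add, add_apply, hα, hβ, zero_add, add_zero] at h
  exact eq_neg_of_add_eq_zero_left h

/-- The antiderivation rule. In the alternating sum for `wedge` with α in the first slot, the zeroth
term is α(v) d; in every other term α stays as the first argument of d, and the index shift costs a
sign. -/
theorem interior_wedge {k : ℕ} (α : V →L[ℝ] ℝ) (v : V) (d : Multivector V k) :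
    interiorSuccCLM k (wedge v d) α = α v • d - wedgePred (k := k) v (interior α d) := by
  ext β
  have e : interiorSuccCLM k (wedge v d) α β = wedge v d (Matrix.vecCons α β) := rfl
  rw [e, wedge_apply, Fin.sum_univ_succ, ContinuousAlternatingMap.sub_apply, sub_eq_add_neg,
    ContinuousAlternatingMap.smul_apply]
  congr 1
  · simp
  cases k with
  | zero => simp [wedgePred]
  | succ k =>
    simp only [wedgePred, wedge_apply, ← Finset.sum_neg_distrib]
    refine Finset.sum_congr rfl fun i _ => ?_
    simp only [Fin.val_succ, pow_succ, mul_neg, mul_one, neg_smul, Matrix.cons_val_succ, interior,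
      ContinuousAlternatingMap.curryLeft_apply_apply]
    congr 4
    ext j
    refine Fin.cases ?_ (fun j => ?_) j <;> simp [Fin.removeNth]

/-- If α(v) = 0, then i_α anticommutes with v ∧ and meets the second i_α, where i_α² = 0. This is
the identity i_{dω} Q = 0 that decouples i_{dω}C from the equation. -/
theorem interior_wedgePred_interior {k : ℕ} {α : V →L[ℝ] ℝ} {v : V} (h : α v = 0)
    (a : Multivector V k) : interior α (wedgePred (k := k) v (interior α a)) = 0 := by
  cases k with
  | zero => rfl
  | succ k =>
    change interiorSuccCLM k (wedge v (interiorSuccCLM k a α)) α = 0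
    rw [interior_wedge, h, ← interior_succ, interior_interior]
    simpa using (wedgePredL (k := k) v).map_zero

/-- The double product alternatizes (x, y) ↦ x(v) y(v) d, which is symmetric in x and y. -/
theorem wedge_wedge {k : ℕ} (v : V) (d : Multivector V k) : wedge v (wedge v d) = 0 := by
  have h := ContinuousAlternatingMap.alternatizeUncurryFin_alternatizeUncurryFinCLM_comp_of_symmetric
    (f := (ContinuousLinearMap.apply ℝ ℝ v).smulRight
      ((ContinuousLinearMap.apply ℝ ℝ v).smulRight d)) fun x y => by
        simp [smul_smul, mul_comm]
  rw [← h, wedge]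
  congr 1
  ext x β
  simp [wedge]

/-- The same anticommutation followed by v ∧ v = 0. It makes Q vanish on the correction term of the
particular solution. -/
theorem wedgePred_interior_wedgePred {k : ℕ} {α : V →L[ℝ] ℝ} {v : V} (h : α v = 0)
    (d : Multivector V (k - 1)) : wedgePred v (interior α (wedgePred (k := k) v d)) = 0 := by
  cases k with
  | zero => rfl
  | succ k =>
    change wedgeCLM k v (interiorSuccCLM k (wedge v d) α) = 0
    rw [interior_wedge, h, zero_smul, zero_sub, map_neg, neg_eq_zero]
    cases k with
    | zero => exact map_zero _
    | succ k => exact wedge_wedge v _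

theorem ext_interior {k : ℕ} {a b : Multivector V (k + 1)}
    (h : ∀ β, interiorSuccCLM k a β = interiorSuccCLM k b β) : a = b := by
  ext β
  have := DFunLike.congr_fun (h (β 0)) (Matrix.vecTail β)
  have e : Matrix.vecCons (β 0) (Matrix.vecTail β) = β := Matrix.cons_head_tail β
  simpa [interiorSuccCLM, e] using this

/-- The push-forward of a multivector under the shear `id - t v ⊗ α`. -/
theorem map_shear {k : ℕ} (α : V →L[ℝ] ℝ) (v : V) (t : ℝ) (a : Multivector V k) :
    map (ContinuousLinearMap.id ℝ V - t • α.smulRight v) a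
      = a - t • wedgePred v (interior α a) := by
  -- Induction on the degree by contracting with an arbitrary covector β. Since β ∘ L = β - t β(v)
  -- α, the inductive hypothesis also yields a t² term; it vanishes because i_α² = 0 (`h3`). The t
  -- terms match because i_α and i_β anticommute (`h4`).
  induction k with
  | zero =>
    ext β
    simp [map_apply, wedgePred, Subsingleton.elim _ β]
  | succ k ih =>
    refine ext_interior fun β => ?_
    set L := ContinuousLinearMap.id ℝ V - t • α.smulRight v with hL
    have hβ : β.comp L = β - (t * β v) • α := by
      ext w
      simp [hL]
      ring
    have h1 : interiorSuccCLM k (map L a) β = map L (interiorSuccCLM k a (β.comp L)) :=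
      (map_interior L β a).symm
    have h2 : wedgePred v (interior α a) = wedge v (interiorSuccCLM k a α) := rfl
    have h3 : wedgePred v (interior α (interiorSuccCLM k a α)) = 0 := by
      rw [← interior_succ, interior_interior]
      exact (wedgePredL (k := k) v).map_zero
    have h4 : wedgePred v (interior α (interiorSuccCLM k a β)) =
        - wedgePred (k := k) v (interior β (interiorSuccCLM k a α)) := by
      cases k with
      | zero => simp [wedgePred]
      | succ k =>
        change wedgeCLM k v (interior α (interior β a)) = -wedgeCLM k v (interior β (interior α a))
        rw [interior_comm, map_neg]
    rw [h1, ih, hβ, h2, map_sub, map_sub, map_smul, map_smul, sub_apply, smul_apply,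
      interior_wedge, ← interiorL_apply, map_sub, map_smul,
      ← wedgePredL_apply, map_sub, map_smul]
    simp only [interiorL_apply, wedgePredL_apply, h3, h4]
    module

/-- Alternatization of continuous multilinear maps as a continuous linear map. -/
def alternatizationCLM (k : ℕ) :
    ContinuousMultilinearMap ℝ (fun _ : Fin k => V) ℝ →L[ℝ] V [⋀^Fin k]→L[ℝ] ℝ :=
  LinearMap.mkContinuous
    { toFun := ContinuousMultilinearMap.alternatization
      map_add' := map_add _
      map_smul' := fun c f => by
        ext v
        simp [ContinuousMultilinearMap.alternatization_apply_apply, Finset.mul_sum,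
          mul_smul_comm] }
    (k.factorial) fun f => by
      refine ContinuousAlternatingMap.opNorm_le_bound _ (by positivity) fun v => ?_
      simp only [LinearMap.coe_mk, AddHom.coe_mk,
        ContinuousMultilinearMap.alternatization_apply_apply]
      refine (norm_sum_le _ _).trans
        ((Finset.sum_le_card_nsmul _ _ (‖f‖ * ∏ i, ‖v i‖) fun σ _ => ?_).trans (by simp [Fintype.card_perm, mul_assoc]))
      have : ‖Equiv.Perm.sign σ • f (v ∘ σ)‖ = ‖f (v ∘ σ)‖ := by
        rcases Int.units_eq_one_or (Equiv.Perm.sign σ) with h | h <;> simp [h]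
      rw [this, ← Equiv.prod_comp σ fun i => ‖v i‖]
      exact f.le_opNorm _

/-- All k! signed permutations of an alternating map equal the map itself. Up to this factor,
alternating maps are thus a continuous linear image of multilinear ones. -/
theorem alternatizationCLM_coe {k : ℕ} (f : V [⋀^Fin k]→L[ℝ] ℝ) :
    alternatizationCLM k f.toContinuousMultilinearMap = (k.factorial : ℝ) • f := by
  ext v
  have : ∀ σ : Equiv.Perm (Fin k), Equiv.Perm.sign σ • f (v ∘ σ) = f v := fun σ => by
    have := f.toAlternatingMap.map_perm v σ
    simp only [ContinuousAlternatingMap.coe_toAlternatingMap] at this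
    rw [this, smul_smul, Int.units_mul_self, one_smul]
  simp [alternatizationCLM, ContinuousMultilinearMap.alternatization_apply_apply, this,
    Fintype.card_perm]

/-- The push-forward of `k`-vectors depends smoothly on the linear map and on the `k`-vector. -/
theorem contDiff_map {k : ℕ} {n : WithTop ℕ∞} :
    ContDiff ℝ n fun p : (V →L[ℝ] W) × Multivector V k => map p.1 p.2 := by
  -- Composition with a tuple of linear maps is continuous multilinear in the tuple, hence smooth.
  -- The push-forward is its restriction to the diagonal tuple, brought back to alternating maps by
  -- alternatization divided by k!.
  have h : (fun p : (V →L[ℝ] W) × Multivector V k => map p.1 p.2) = fun p =>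
      ((k.factorial : ℝ)⁻¹) • alternatizationCLM k
        (ContinuousMultilinearMap.compContinuousLinearMapContinuousMultilinear ℝ
          (fun _ : Fin k => W →L[ℝ] ℝ) (fun _ : Fin k => V →L[ℝ] ℝ) ℝ
          (fun _ => (ContinuousLinearMap.compL ℝ V W ℝ).flip p.1)
          (ContinuousAlternatingMap.toContinuousMultilinearMapCLM ℝ p.2)) := by
    funext p
    have := alternatizationCLM_coe (map p.1 p.2)
    rw [eq_inv_smul_iff₀ (by positivity), ← this]
    rfl
  have h1 : ContDiff ℝ n fun p : (V →L[ℝ] W) × Multivector V k =>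
      (ContinuousLinearMap.compL ℝ V W ℝ).flip p.1 :=
    ((ContinuousLinearMap.compL ℝ V W ℝ).flip.contDiff (n := n)).comp contDiff_fst
  have h2 : ContDiff ℝ n fun p : (V →L[ℝ] W) × Multivector V k =>
      (ContinuousAlternatingMap.toContinuousMultilinearMapCLM ℝ :
        Multivector V k →L[ℝ] _) p.2 :=
    (ContinuousLinearMap.contDiff _).comp contDiff_snd
  rw [h]
  refine ContDiff.const_smul _ ?_
  refine (ContinuousLinearMap.contDiff (alternatizationCLM (V := W →L[ℝ] ℝ) k)).comp ?_
  refine ContDiff.clm_apply ?_ h2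
  exact (ContinuousMultilinearMap.contDiff
      (ContinuousMultilinearMap.compContinuousLinearMapContinuousMultilinear ℝ
        (fun _ : Fin k => W →L[ℝ] ℝ) (fun _ : Fin k => V →L[ℝ] ℝ) ℝ)).comp
      (contDiff_pi.2 fun _ => h1)

end Multivector

/-! ### Smooth dependence of integrals on parameters -/

section Parametric

variable {P F : Type*} [NormedAddCommGroup P] [NormedSpace ℝ P] [NormedAddCommGroup F]
  [NormedSpace ℝ F]

/-- The integral is the value at 0 of the convolution of the indicator of (a, b] with y ↦ χ(y) f(p,
-y), where the cutoff χ provides the compact support needed to differentiate convolutions in a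
parameter. -/
theorem contDiffOn_intervalIntegral {n : ℕ∞} {s : Set P} (hs : IsOpen s) {f : P → ℝ → F}
    (hf : ContDiffOn ℝ n (Function.uncurry f) (s ×ˢ univ)) {a b : ℝ} (hab : a ≤ b) :
    ContDiffOn ℝ n (fun p => ∫ t in a..b, f p t) s := by
  -- The inner radius exceeds |a| and |b|, so χ(-t) = 1 on the whole interval of integration.
  let χ : ContDiffBump (0 : ℝ) :=
    ⟨max |a| |b| + 1, max |a| |b| + 2, by positivity, by linarith⟩
  have hχ : ∀ t ∈ Ioc a b, χ (-t) = 1 := fun t ht => by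
    refine χ.one_of_mem_closedBall ?_
    rw [mem_closedBall_zero_iff, norm_neg, Real.norm_eq_abs]
    exact (abs_le_max_abs_abs ht.1.le ht.2).trans (by linarith : _ ≤ max |a| |b| + 1)
  have hg : ContDiffOn ℝ n (Function.uncurry fun (p : P) (y : ℝ) => χ y • f p (-y))
      (s ×ˢ univ) := by
    refine ContDiffOn.smul (χ.contDiff.comp contDiff_snd).contDiffOn ?_
    exact hf.comp (contDiff_fst.prodMk contDiff_snd.neg).contDiffOn fun p hp => ⟨hp.1, mem_univ _⟩
  have key := contDiffOn_convolution_right_with_param_comp (μ := volume)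
    (ContinuousLinearMap.lsmul ℝ ℝ : ℝ →L[ℝ] F →L[ℝ] F) (v := fun _ => (0 : ℝ))
    (f := (Ioc a b).indicator fun _ => (1 : ℝ)) (g := fun p y => χ y • f p (-y))
    contDiffOn_const hs
    (isCompact_closedBall (0 : ℝ) χ.rOut)
    (fun p y _ hy => by
      rw [χ.zero_of_le_dist (le_of_lt (by simpa using hy)), zero_smul])
    ((integrable_indicator_iff measurableSet_Ioc).2
      (integrableOn_const (by simp))).locallyIntegrable hg
  refine key.congr fun p _ => ?_
  rw [convolution_def, intervalIntegral.integral_of_le hab, ← integral_indicator measurableSet_Ioc]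
  refine integral_congr_ae (Eventually.of_forall fun t => ?_)
  by_cases ht : t ∈ Ioc a b
  · simp [ht, hχ t ht]
  · simp [ht]

end Parametric

/-! ### Smoothness of superposition operators on spaces of continuous functions -/

section Superposition

variable {K : Type*} [TopologicalSpace K] [CompactSpace K]
  {E F : Type*} [NormedAddCommGroup E] [NormedSpace ℝ E] [NormedAddCommGroup F] [NormedSpace ℝ F]

/-- Pointwise application of a continuous family of continuous linear maps. -/
def pointwiseApply : C(K, E →L[ℝ] F) →L[ℝ] C(K, E) →L[ℝ] C(K, F) :=
  LinearMap.mkContinuous₂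
    (LinearMap.mk₂ ℝ (fun L γ => ⟨fun t => L t (γ t), by fun_prop⟩)
      (fun _ _ _ => by ext; simp) (fun _ _ _ => by ext; simp)
      (fun _ _ _ => by ext; simp) (fun _ _ _ => by ext; simp)) 1 fun L γ => by
    rw [one_mul]
    refine (ContinuousMap.norm_le _ (by positivity)).2 fun t => ?_
    exact (L t).le_of_opNorm_le_of_le (L.norm_coe_le_norm t) (γ.norm_coe_le_norm t)

/-- The mean value inequality on a ball around γ(t) bounds the remainder pointwise; uniform
continuity of f' makes the radius independent of t, so the bound holds in the sup norm. -/
theorem hasFDerivAt_superposition (f : C(E, F)) (f' : C(E, E →L[ℝ] F))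
    (hf : ∀ x, HasFDerivAt f (f' x) x) (hf' : UniformContinuous f') (γ : C(K, E)) :
    HasFDerivAt (fun γ : C(K, E) => f.comp γ) (pointwiseApply (f'.comp γ)) γ := by
  rw [hasFDerivAt_iff_isLittleO_nhds_zero, Asymptotics.isLittleO_iff]
  intro c hc
  obtain ⟨δ, hδ, h⟩ := Metric.uniformContinuous_iff.1 hf' c hc
  filter_upwards [Metric.ball_mem_nhds (0 : C(K, E)) hδ] with η hη
  refine (ContinuousMap.norm_le _ (by positivity)).2 fun t => ?_
  have hηt : ‖η t‖ < δ := (η.norm_coe_le_norm t).trans_lt (by simpa using hη)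
  have := (convex_ball (γ t) δ).norm_image_sub_le_of_norm_hasFDerivWithin_le' (𝕜 := ℝ)
    (f := f) (f' := fun x => f' x) (φ := f' (γ t)) (C := c) (x := γ t) (y := γ t + η t)
    (fun x _ => (hf x).hasFDerivWithinAt)
    (fun x hx => by simpa [dist_eq_norm] using (h hx).le) (Metric.mem_ball_self hδ)
    (by simpa using hηt)
  rw [add_sub_cancel_left] at this
  exact this.trans (mul_le_mul_of_nonneg_left (η.norm_coe_le_norm t) hc.le)

/-- The derivative is superposition by f' followed by the continuous linear `pointwiseApply`, so one
order of smoothness reduces to the previous one for f'. The target F varies in the induction, being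
replaced by E →L F, which is why both spaces share a universe. -/
theorem contDiff_superposition_nat.{u} (n : ℕ) {E : Type u} [NormedAddCommGroup E]
    [NormedSpace ℝ E] : ∀ {F : Type u} [NormedAddCommGroup F] [NormedSpace ℝ F] (f : C(E, F)),
      ContDiff ℝ n f → HasCompactSupport f → ContDiff ℝ n fun γ : C(K, E) => f.comp γ := by
  induction n with
  | zero =>
    intro F _ _ f _ _
    exact contDiff_zero.2 (ContinuousMap.continuous_postcomp f)
  | succ n ih =>
    intro F _ _ f hf hc
    have hf1 : ContDiff ℝ n (fderiv ℝ f) := hf.fderiv_right (by norm_cast)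
    let f' : C(E, E →L[ℝ] F) := ⟨fderiv ℝ f, hf1.continuous⟩
    have hc' : HasCompactSupport f' := hc.fderiv ℝ
    push_cast
    refine contDiff_succ_iff_hasFDerivAt.2 ⟨fun γ => pointwiseApply (f'.comp γ), ?_, fun γ => ?_⟩
    · exact pointwiseApply.contDiff.comp (ih f' hf1 hc')
    · exact hasFDerivAt_superposition f f'
        (fun x => (hf.differentiable (by simp) x).hasFDerivAt)
        (hc'.uniformContinuous_of_continuous f'.continuous) γ

theorem contDiff_superposition.{u} {E F : Type u} [NormedAddCommGroup E] [NormedSpace ℝ E]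
    [NormedAddCommGroup F] [NormedSpace ℝ F] (f : C(E, F)) (hf : ContDiff ℝ ∞ f)
    (hc : HasCompactSupport f) : ContDiff ℝ ∞ fun γ : C(K, E) => f.comp γ :=
  contDiff_infty.2 fun n => contDiff_superposition_nat n f (hf.of_le (by exact_mod_cast le_top)) hc

end Superposition

/-! ### Smooth dependence of solutions of ordinary differential equations on the initial value -/

section LocalFlow

variable {E : Type*} [NormedAddCommGroup E]

/-- Extension of a curve on `[-1, 1]` to the real line by its values at the end points. -/
def extendCurve (γ : C(Icc (-1 : ℝ) 1, E)) (t : ℝ) : E := γ (projIcc (-1) 1 (by norm_num) t)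

theorem continuous_extendCurve (γ : C(Icc (-1 : ℝ) 1, E)) : Continuous (extendCurve γ) :=
  γ.continuous.comp continuous_projIcc

theorem norm_extendCurve_le (γ : C(Icc (-1 : ℝ) 1, E)) (t : ℝ) : ‖extendCurve γ t‖ ≤ ‖γ‖ :=
  γ.norm_coe_le_norm _

theorem extendCurve_coe (γ : C(Icc (-1 : ℝ) 1, E)) (t : Icc (-1 : ℝ) 1) :
    extendCurve γ t = γ t := by simp [extendCurve]

variable [NormedSpace ℝ E]

/-- The primitive, vanishing at `0`, of a curve on `[-1, 1]`. -/
def curvePrimitive : C(Icc (-1 : ℝ) 1, E) →L[ℝ] C(Icc (-1 : ℝ) 1, E) :=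
  LinearMap.mkContinuous
    { toFun := fun γ => ⟨fun t => ∫ τ in (0 : ℝ)..t, extendCurve γ τ,
        (intervalIntegral.continuous_primitive
          (fun a b => (continuous_extendCurve γ).intervalIntegrable a b) 0).comp
          continuous_subtype_val⟩
      map_add' := fun γ η => by
        ext t
        exact intervalIntegral.integral_add ((continuous_extendCurve γ).intervalIntegrable _ _)
          ((continuous_extendCurve η).intervalIntegrable _ _)
      map_smul' := fun c γ => by
        ext t
        exact intervalIntegral.integral_smul c _ } 1 fun γ => by
    refine (ContinuousMap.norm_le _ (by positivity)).2 fun t => ?_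
    refine (intervalIntegral.norm_integral_le_of_norm_le_const
      fun τ _ => norm_extendCurve_le γ τ).trans ?_
    rw [one_mul, sub_zero]
    exact mul_le_of_le_one_right (norm_nonneg _) (abs_le.2 t.2)

theorem curvePrimitive_apply (γ : C(Icc (-1 : ℝ) 1, E)) (t : Icc (-1 : ℝ) 1) :
    curvePrimitive γ t = ∫ τ in (0 : ℝ)..t, extendCurve γ τ := rfl

/-- The constant curves, as a continuous linear map. -/
def constCurve : E →L[ℝ] C(Icc (-1 : ℝ) 1, E) :=
  LinearMap.mkContinuous
    { toFun := fun x => ContinuousMap.const _ x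
      map_add' := fun _ _ => rfl
      map_smul' := fun _ _ => rfl } 1 fun x => by
    refine (ContinuousMap.norm_le _ (by positivity)).2 fun t => by
      rw [one_mul]
      exact le_rfl

theorem constCurve_apply (x : E) (t : Icc (-1 : ℝ) 1) : constCurve x t = x := rfl

/-- For a smooth compactly supported vector field `f`, the solutions of `γ' = s f(γ)`, `γ(0) = x`,
on `[-1, 1]` depend smoothly on `(s, x)` near `s = 0`. -/
theorem exists_smooth_integral_solution [CompleteSpace E] (f : C(E, E)) (hf : ContDiff ℝ ∞ f)
    (hc : HasCompactSupport f) (x₀ : E) :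
    ∃ γ : ℝ × E → C(Icc (-1 : ℝ) 1, E), ContDiffAt ℝ ∞ γ (0, x₀) ∧ γ (0, x₀) = constCurve x₀ ∧
      ∀ᶠ p in 𝓝 ((0 : ℝ), x₀),
        γ p = constCurve p.2 + p.1 • curvePrimitive (f.comp (γ p)) := by
  -- Zeros of G are the solutions of the integral equation. At s = 0 the nonlinear term disappears,
  -- so the partial derivative in the curve is the identity and the implicit function theorem
  -- applies.
  let G : (ℝ × E) × C(Icc (-1 : ℝ) 1, E) → C(Icc (-1 : ℝ) 1, E) := fun q =>
    q.2 - constCurve q.1.2 - q.1.1 • curvePrimitive (f.comp q.2)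
  have hN := contDiff_superposition (K := Icc (-1 : ℝ) 1) f hf hc
  have hG : ContDiff ℝ ∞ G :=
    (contDiff_snd.sub (constCurve.contDiff.comp (contDiff_snd.comp contDiff_fst))).sub
      ((contDiff_fst.comp contDiff_fst).smul
        (curvePrimitive.contDiff.comp (hN.comp contDiff_snd)))
  have hG0 : G ((0, x₀), constCurve x₀) = 0 := by simp [G]
  have hd : fderiv ℝ G ((0, x₀), constCurve x₀) ∘L .inr ℝ (ℝ × E) (C(Icc (-1 : ℝ) 1, E)) =
      ContinuousLinearMap.id ℝ _ := by
    have h1 : HasFDerivAt (fun γ => G ((0, x₀), γ))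
        (fderiv ℝ G ((0, x₀), constCurve x₀) ∘L .inr ℝ (ℝ × E) (C(Icc (-1 : ℝ) 1, E)))
        (constCurve x₀) :=
      ((hG.differentiable (by simp)) _).hasFDerivAt.comp (constCurve x₀)
        (hasFDerivAt_prodMk_right _ _)
    have h2 : HasFDerivAt (fun γ => G ((0, x₀), γ)) (ContinuousLinearMap.id ℝ _)
        (constCurve x₀) := by
      simpa [G] using (hasFDerivAt_id (𝕜 := ℝ) (constCurve x₀)).sub_const (constCurve x₀)
    exact h1.unique h2
  have hinv : (fderiv ℝ G ((0, x₀), constCurve x₀) ∘L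
      .inr ℝ (ℝ × E) (C(Icc (-1 : ℝ) 1, E))).IsInvertible := by
    rw [hd]
    exact ⟨ContinuousLinearEquiv.refl ℝ _, rfl⟩
  have hGa : ContDiffAt ℝ ∞ G ((0, x₀), constCurve x₀) := hG.contDiffAt
  refine ⟨hGa.implicitFunction (by simp) hinv, hGa.contDiffAt_implicitFunction (by simp) hinv,
    hGa.implicitFunction_apply_self (by simp) hinv, ?_⟩
  filter_upwards [hGa.eventually_apply_implicitFunction (by simp) hinv] with p hp
  rw [hG0] at hp
  simp only [G] at hp
  rw [sub_sub, sub_eq_zero] at hp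
  exact hp

/-- The fundamental theorem of calculus applied to the integral equation, at interior times only,
since the extended curve is frozen beyond ±1. -/
theorem hasDerivAt_extendCurve [CompleteSpace E] {f : C(E, E)} {s : ℝ} {x : E}
    {γ : C(Icc (-1 : ℝ) 1, E)}
    (h : γ = constCurve x + s • curvePrimitive (f.comp γ)) {t : ℝ} (ht : t ∈ Ioo (-1 : ℝ) 1) :
    HasDerivAt (extendCurve γ) (s • f (extendCurve γ t)) t := by
  have h1 : HasDerivAt (fun t => x + s • ∫ τ in (0 : ℝ)..t, extendCurve (f.comp γ) τ)
      (s • f (extendCurve γ t)) t :=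
    (((continuous_extendCurve (f.comp γ)).integral_hasStrictDerivAt 0 t).hasDerivAt.const_smul
      s).const_add x
  refine h1.congr_of_eventuallyEq ?_
  filter_upwards [Ioo_mem_nhds ht.1 ht.2] with τ hτ
  have h2 := extendCurve_coe γ ⟨τ, hτ.1.le, hτ.2.le⟩
  simp only at h2
  rw [h2]
  conv_lhs => rw [h]
  rfl

theorem extendCurve_zero {f : C(E, E)} {s : ℝ} {x : E} {γ : C(Icc (-1 : ℝ) 1, E)}
    (h : γ = constCurve x + s • curvePrimitive (f.comp γ)) : extendCurve γ 0 = x := by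
  have h2 := extendCurve_coe γ ⟨0, by norm_num⟩
  simp only at h2
  rw [h2, h]
  simp [curvePrimitive_apply, constCurve_apply]

end LocalFlow

/-! ### Integral curves, derivatives of charts, smooth vector fields -/

section Charts

variable {E : Type*} [NormedAddCommGroup E] [NormedSpace ℝ E]
  {M : Type*} [TopologicalSpace M] [ChartedSpace E M]

/-- The derivative at `m` of the preferred chart at `x`. -/
def chartD (x m : M) : E →L[ℝ] E := mfderiv 𝓘(ℝ, E) 𝓘(ℝ, E) (extChartAt 𝓘(ℝ, E) x) m

/-- The derivative, at the image of `m`, of the inverse of the preferred chart at `x`. -/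
def chartDinv (x m : M) : E →L[ℝ] E :=
  mfderiv 𝓘(ℝ, E) 𝓘(ℝ, E) (extChartAt 𝓘(ℝ, E) x).symm (extChartAt 𝓘(ℝ, E) x m)

theorem isMIntegralCurve_flow {X : ∀ m : M, TangentSpace 𝓘(ℝ, E) m}
    (hXc : IsCompleteVectorField X) (m : M) :
    IsMIntegralCurve (I := 𝓘(ℝ, E)) (fun t => flow X t m) X := by
  have h := hXc m
  have e : (fun t => flow X t m) = h.choose := by
    funext t
    rw [flow, dif_pos h]
  rw [e]
  exact h.choose_spec.2

theorem flow_zero {X : ∀ m : M, TangentSpace 𝓘(ℝ, E) m}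
    (hXc : IsCompleteVectorField X) (m : M) : flow X 0 m = m := by
  have h := hXc m
  rw [flow, dif_pos h]
  exact h.choose_spec.1

variable [IsManifold 𝓘(ℝ, E) ∞ M]

theorem chartDinv_comp_chartD {x m : M} (h : m ∈ (chartAt E x).source) :
    (chartDinv x m).comp (chartD x m) = ContinuousLinearMap.id ℝ E := by
  have := mfderivWithin_extChartAt_symm_comp_mfderiv_extChartAt' (I := 𝓘(ℝ, E)) (x := x) (y := m)
    (by simpa using h)
  rw [modelWithCornersSelf_coe, range_id, mfderivWithin_univ] at this
  exact this

/-- The coordinate expression of a vector field in the preferred chart at `x`. -/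
def chartField (X : ∀ m : M, TangentSpace 𝓘(ℝ, E) m) (x m : M) : E := chartD x m (X m)

/-- On each fibre, the trivialization of the tangent bundle at x is the derivative of the chart at
x. -/
theorem isSmoothVectorField_iff {X : ∀ m : M, TangentSpace 𝓘(ℝ, E) m} :
    IsSmoothVectorField X ↔ ∀ x : M, ContMDiffOn 𝓘(ℝ, E) 𝓘(ℝ, E) ∞
      (chartField X x) (chartAt E x).source := by
  have key : ∀ x : M,
      ContMDiffOn 𝓘(ℝ, E) 𝓘(ℝ, E).tangent ∞
        (fun m => (⟨m, X m⟩ : TangentBundle 𝓘(ℝ, E) M)) (chartAt E x).source ↔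
      ContMDiffOn 𝓘(ℝ, E) 𝓘(ℝ, E) ∞ (chartField X x) (chartAt E x).source := fun x => by
    have h := (trivializationAt E (TangentSpace 𝓘(ℝ, E)) x).contMDiffOn_section_baseSet_iff
      (IB := 𝓘(ℝ, E)) (n := ∞) (s := X)
    rw [TangentBundle.trivializationAt_baseSet] at h
    refine h.trans (contMDiffOn_congr fun m hm => ?_)
    have h1 := TangentBundle.continuousLinearMapAt_trivializationAt (I := 𝓘(ℝ, E)) hm
    have h2 := (trivializationAt E (TangentSpace 𝓘(ℝ, E)) x).coe_linearMapAt_of_mem (R := ℝ)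
      (b := m) (by simpa using hm)
    exact ((DFunLike.congr_fun h1.symm (X m)).trans (congrFun h2 (X m))).symm
  refine ⟨fun h x => (key x).1 h.contMDiffOn, fun h m => ?_⟩
  exact ((key m).2 (h m)).contMDiffAt ((chartAt E m).open_source.mem_nhds (mem_chart_source E m))

end Charts

/-! ### Joint smoothness of the flow in time and position -/

section LocalFlowManifold

variable {E : Type*} [NormedAddCommGroup E] [NormedSpace ℝ E] [FiniteDimensional ℝ E]
  {M : Type*} [TopologicalSpace M] [ChartedSpace E M] [IsManifold 𝓘(ℝ, E) ∞ M]

/-- Near a given point, a smooth vector field is represented in the preferred chart by a smooth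
compactly supported vector field. -/
theorem exists_local_representative {X : ∀ m : M, TangentSpace 𝓘(ℝ, E) m}
    (hX : IsSmoothVectorField X) (x : M) :
    ∃ f : C(E, E), ContDiff ℝ ∞ f ∧ HasCompactSupport f ∧ ∃ r > 0,
      Metric.ball (extChartAt 𝓘(ℝ, E) x x) r ⊆ (extChartAt 𝓘(ℝ, E) x).target ∧
      ∀ u ∈ Metric.ball (extChartAt 𝓘(ℝ, E) x x) r,
        f u = chartField X x ((extChartAt 𝓘(ℝ, E) x).symm u) := by
  set e := extChartAt 𝓘(ℝ, E) x with he
  let v : E → E := fun u => chartField X x (e.symm u)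
  have hv : ContDiffOn ℝ ∞ v e.target := by
    rw [← contMDiffOn_iff_contDiffOn]
    exact (isSmoothVectorField_iff.1 hX x).comp (contMDiffOn_extChartAt_symm x)
      fun u hu => by simpa [he] using e.map_target hu
  have ho : IsOpen e.target := isOpen_extChartAt_target x
  obtain ⟨R, hR, hRt⟩ := Metric.isOpen_iff.1 ho (e x) (mem_extChartAt_target x)
  -- The cutoff equals 1 on the ball of radius R / 4, which becomes r, and is supported in the
  -- closed ball of radius R / 2 inside the chart target.
  let χ : ContDiffBump (e x) := ⟨R / 4, R / 2, by positivity, by linarith⟩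
  have hχ : tsupport χ ⊆ e.target := by
    rw [χ.tsupport_eq]
    exact (Metric.closedBall_subset_ball (by change R / 2 < R; linarith)).trans hRt
  have hf : ContDiff ℝ ∞ fun u => χ u • v u := contDiff_iff_contDiffAt.2 fun u => by
    by_cases hu : u ∈ tsupport χ
    · exact χ.contDiff.contDiffAt.smul ((hv u (hχ hu)).contDiffAt (ho.mem_nhds (hχ hu)))
    · refine (contDiffAt_const (c := (0 : E))).congr_of_eventuallyEq ?_
      filter_upwards [(isClosed_tsupport χ).isOpen_compl.mem_nhds hu] with w hw
      rw [image_eq_zero_of_notMem_tsupport hw, zero_smul]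
  refine ⟨⟨fun u => χ u • v u, hf.continuous⟩, hf, χ.hasCompactSupport.smul_right, R / 4,
    by positivity, (Metric.ball_subset_ball (by linarith)).trans hRt, fun u hu => ?_⟩
  change χ u • v u = v u
  rw [χ.one_of_mem_closedBall (Metric.ball_subset_closedBall hu), one_smul]

variable [T2Space M]

omit [FiniteDimensional ℝ E] in
theorem flow_eq_of_isMIntegralCurve {X : ∀ m : M, TangentSpace 𝓘(ℝ, E) m}
    (hX : IsSmoothVectorField X) (hXc : IsCompleteVectorField X) {γ : ℝ → M}
    (hγ : IsMIntegralCurve (I := 𝓘(ℝ, E)) γ X) (t : ℝ) : flow X t (γ 0) = γ t :=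
  congrFun (isMIntegralCurve_Ioo_eq_of_contMDiff_boundaryless (t₀ := 0)
    (ContMDiff.of_le hX (by simp)) (isMIntegralCurve_flow hXc (γ 0)) hγ (flow_zero hXc _)) t

omit [FiniteDimensional ℝ E] in
theorem flow_add {X : ∀ m : M, TangentSpace 𝓘(ℝ, E) m}
    (hX : IsSmoothVectorField X) (hXc : IsCompleteVectorField X) (s t : ℝ) (m : M) :
    flow X (s + t) m = flow X s (flow X t m) := by
  have := flow_eq_of_isMIntegralCurve hX hXc ((isMIntegralCurve_flow hXc m).comp_add t) s
  simpa using this.symm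

/-- In a chart, small time is traded for a small factor in front of the vector field: the solution
on [-1, 1] of γ' = 2s f(γ), evaluated at 1/2, is the flow at time s by uniqueness of integral
curves. -/
theorem contMDiffAt_flow_zero {X : ∀ m : M, TangentSpace 𝓘(ℝ, E) m}
    (hX : IsSmoothVectorField X) (hXc : IsCompleteVectorField X) (m₀ : M) :
    ContMDiffAt (𝓘(ℝ, ℝ).prod 𝓘(ℝ, E)) 𝓘(ℝ, E) ∞ (fun p : ℝ × M => flow X p.1 p.2) (0, m₀) := by
  obtain ⟨f, hf, hfc, r, hr, hrt, hfX⟩ := exists_local_representative hX m₀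
  set e := extChartAt 𝓘(ℝ, E) m₀ with he
  have : CompleteSpace E := FiniteDimensional.complete ℝ E
  obtain ⟨γ, hγ, hγ0, hγe⟩ := exists_smooth_integral_solution f hf hfc (e m₀)
  -- The factor 2 permits evaluation at the interior time 1/2, where the curve is known to be
  -- differentiable.
  let q : ℝ × M → ℝ × E := fun p => (2 * p.1, e p.2)
  have hq : ContMDiffAt (𝓘(ℝ, ℝ).prod 𝓘(ℝ, E)) 𝓘(ℝ, ℝ × E) ∞ q (0, m₀) := by
    refine ContMDiffAt.prodMk_space ?_ ?_
    · exact (contDiff_const.mul contDiff_id : ContDiff ℝ ∞ fun t : ℝ => 2 * t).contMDiff.contMDiffAt.comp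
        (0, m₀) contMDiffAt_fst
    · exact contMDiffAt_extChartAt.comp (0, m₀) contMDiffAt_snd
  have hq0 : q (0, m₀) = (0, e m₀) := by simp [q]
  -- Closeness in the sup norm keeps the entire curve in the ball where f represents X.
  have hclose : ∀ᶠ p in 𝓝 ((0 : ℝ), e m₀), ‖γ p - constCurve (e m₀)‖ < r := by
    have : Tendsto (fun p => ‖γ p - constCurve (e m₀)‖) (𝓝 (0, e m₀)) (𝓝 0) := by
      have := (hγ.continuousAt.sub (continuousAt_const (y := constCurve (e m₀)))).norm
      simpa [ContinuousAt, hγ0] using this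
    exact this.eventually (gt_mem_nhds hr)
  have key : (fun p : ℝ × M => flow X p.1 p.2) =ᶠ[𝓝 (0, m₀)]
      fun p => e.symm (γ (q p) ⟨1 / 2, by norm_num, by norm_num⟩) := by
    have hqt : Tendsto q (𝓝 (0, m₀)) (𝓝 (0, e m₀)) := hq0 ▸ hq.continuousAt
    have hsrc : ∀ᶠ p : ℝ × M in 𝓝 (0, m₀), p.2 ∈ e.source :=
      continuousAt_snd.eventually (extChartAt_source_mem_nhds m₀)
    filter_upwards [hqt.eventually hγe, hqt.eventually hclose, hsrc] with p hp hpr hps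
    have hball : ∀ t, extendCurve (γ (q p)) t ∈ Metric.ball (e m₀) r := fun t => by
      rw [Metric.mem_ball, dist_eq_norm]
      exact (norm_extendCurve_le (γ (q p) - constCurve (e m₀)) t).trans_lt hpr
    let c : ℝ → M := fun t => e.symm (extendCurve (γ (q p)) t)
    have hc : IsMIntegralCurveOn (I := 𝓘(ℝ, E)) c ((2 * p.1) • X) (Ioo (-1) 1) := by
      intro t ht
      have hmem := hrt (hball t)
      have hcs : c t ∈ (chartAt E m₀).source := by
        simpa only [he, extChartAt_source] using e.map_target hmem
      let D : E →L[ℝ] E := mfderiv 𝓘(ℝ, E) 𝓘(ℝ, E) e.symm (extendCurve (γ (q p)) t)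
      have hD : D (chartField X m₀ (c t)) = X (c t) := by
        have h := chartDinv_comp_chartD hcs
        have hr : e (c t) = extendCurve (γ (q p)) t := e.right_inv hmem
        have hD : chartDinv m₀ (c t) = D := by
          change mfderiv 𝓘(ℝ, E) 𝓘(ℝ, E) e.symm (e (c t)) = _
          rw [hr]
        rw [hD] at h
        exact DFunLike.congr_fun h (X (c t))
      have h1 : HasMFDerivAt 𝓘(ℝ, ℝ) 𝓘(ℝ, E) (extendCurve (γ (q p))) t
          (ContinuousLinearMap.toSpanSingleton ℝ ((2 * p.1) • f (extendCurve (γ (q p)) t))) :=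
        (hasDerivAt_extendCurve hp ht).hasFDerivAt.hasMFDerivAt
      have h2 : HasMFDerivAt 𝓘(ℝ, E) 𝓘(ℝ, E) e.symm (extendCurve (γ (q p)) t) D := by
        have := (mdifferentiableWithinAt_extChartAt_symm (I := 𝓘(ℝ, E)) hmem)
        rw [modelWithCornersSelf_coe, range_id, mdifferentiableWithinAt_univ] at this
        exact this.hasMFDerivAt
      refine ((h2.comp t h1).congr_mfderiv ?_).hasMFDerivWithinAt
      have h5 : D.comp (ContinuousLinearMap.toSpanSingleton ℝ
          ((2 * p.1) • f (extendCurve (γ (q p)) t))) =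
          (1 : ℝ →L[ℝ] ℝ).smulRight ((2 * p.1) • (X (c t) : E)) := by
        ext
        simp [hfX _ (hball t), ← hD, c]
        exact (one_smul ℝ _).symm
      exact h5
    have hfl : IsMIntegralCurveOn (I := 𝓘(ℝ, E)) ((fun t => flow X t p.2) ∘ (· * (2 * p.1)))
        ((2 * p.1) • X) (Ioo (-1) 1) :=
      ((isMIntegralCurve_flow hXc p.2).comp_mul (2 * p.1)).isMIntegralCurveOn _
    have h0 : ((fun t => flow X t p.2) ∘ (· * (2 * p.1))) 0 = c 0 := by
      simp only [Function.comp_apply, zero_mul, flow_zero hXc, c, extendCurve_zero hp, q]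
      exact (e.left_inv hps).symm
    have hs : ContMDiff 𝓘(ℝ, E) 𝓘(ℝ, E).tangent 1
        (fun m => (⟨m, ((2 * p.1) • X) m⟩ : TangentBundle 𝓘(ℝ, E) M)) := by
      refine ContMDiff.of_le (n := ∞) ?_ (by simp)
      refine isSmoothVectorField_iff.2 fun x => ?_
      have h6 : chartField ((2 * p.1) • X) x = fun m => (2 * p.1) • chartField X x m :=
        funext fun m => (chartD (E := E) x m).map_smul (2 * p.1) (X m : E)
      rw [h6]
      exact (contDiff_const_smul (2 * p.1)).contMDiff.comp_contMDiffOn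
        (isSmoothVectorField_iff.1 hX x)
    have := isMIntegralCurveOn_Ioo_eqOn_of_contMDiff_boundaryless (t₀ := 0) (by simp) hs hfl hc h0
      (show (1 / 2 : ℝ) ∈ Ioo (-1 : ℝ) 1 by constructor <;> norm_num)
    simp only [Function.comp_apply, c] at this
    rw [show 1 / 2 * (2 * p.1) = p.1 by ring] at this
    rw [this, ← extendCurve_coe]
  refine ContMDiffAt.congr_of_eventuallyEq ?_ key
  have h7 : ContMDiffAt 𝓘(ℝ, ℝ × E) 𝓘(ℝ, C(Icc (-1 : ℝ) 1, E)) ∞ γ (q (0, m₀)) := by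
    rw [hq0]
    exact hγ.contMDiffAt
  have h8 : ContMDiffAt (𝓘(ℝ, ℝ).prod 𝓘(ℝ, E)) 𝓘(ℝ, E) ∞
      (fun p => γ (q p) ⟨1 / 2, by norm_num, by norm_num⟩) (0, m₀) :=
    (ContinuousMap.evalCLM ℝ (⟨1 / 2, by norm_num, by norm_num⟩ : Icc (-1 : ℝ) 1)
      ).contDiff.contMDiff.contMDiffAt.comp (0, m₀) (h7.comp (0, m₀) hq)
  refine ContMDiffAt.comp (0, m₀) (g := e.symm) ?_ h8
  rw [hq0, hγ0, constCurve_apply]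
  exact (contMDiffOn_extChartAt_symm m₀).contMDiffAt (extChartAt_target_mem_nhds m₀)

/-- The flow of a smooth complete vector field is jointly smooth in time and position. -/
theorem contMDiff_flow {X : ∀ m : M, TangentSpace 𝓘(ℝ, E) m}
    (hX : IsSmoothVectorField X) (hXc : IsCompleteVectorField X) :
    ContMDiff (𝓘(ℝ, ℝ).prod 𝓘(ℝ, E)) 𝓘(ℝ, E) ∞ (fun p : ℝ × M => flow X p.1 p.2) := by
  -- For finite n, being C^n at a point is an open condition; this makes the set of good times S
  -- open.
  refine contMDiff_infty.2 fun n => ?_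
  rintro ⟨t₀, m₀⟩
  let S : Set ℝ := {t | ContMDiffAt (𝓘(ℝ, ℝ).prod 𝓘(ℝ, E)) 𝓘(ℝ, E) n
    (fun p : ℝ × M => flow X p.1 p.2) (t, m₀)}
  have hn : ∀ q : ℝ × M, ContMDiffAt (𝓘(ℝ, ℝ).prod 𝓘(ℝ, E)) 𝓘(ℝ, E) n
      (fun p : ℝ × M => flow X p.1 p.2) q → ∀ᶠ q' in 𝓝 q,
        ContMDiffAt (𝓘(ℝ, ℝ).prod 𝓘(ℝ, E)) 𝓘(ℝ, E) n (fun p : ℝ × M => flow X p.1 p.2) q' :=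
    fun q h => (contMDiffAt_iff_contMDiffAt_nhds (by simp)).1 h
  have h0 : ∀ m, ContMDiffAt (𝓘(ℝ, ℝ).prod 𝓘(ℝ, E)) 𝓘(ℝ, E) n
      (fun p : ℝ × M => flow X p.1 p.2) (0, m) := fun m =>
    (contMDiffAt_flow_zero hX hXc m).of_le (by exact_mod_cast le_top)
  have hopen : IsOpen S := isOpen_iff_eventually.2 fun t ht =>
    (Continuous.prodMk_left m₀).continuousAt.eventually (hn (t, m₀) ht)
  have hclosed : IsClosed S := by
    refine closure_subset_iff_isClosed.1 fun t ht => ?_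
    -- If t is a limit of good times, choose a good τ so close to t that the flow is C^n at (t - τ,
    -- Fl^τ(m₀)), a point near (0, Fl^t(m₀)). Then factor Fl^s = Fl^{s-τ} ∘ Fl^τ for s near t.
    have hlim : Tendsto (fun τ => (t - τ, flow X τ m₀)) (𝓝 t) (𝓝 (0, flow X t m₀)) := by
      have := (continuous_const.sub continuous_id : Continuous fun τ => t - τ).prodMk
        (isMIntegralCurve_flow hXc m₀).continuous
      simpa using this.tendsto t
    obtain ⟨τ, hτ, hτS⟩ := mem_closure_iff_nhds.1 ht _ (hlim.eventually (hn _ (h0 (flow X t m₀))))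
    have h1 : ContMDiffAt (𝓘(ℝ, ℝ).prod 𝓘(ℝ, E)) (𝓘(ℝ, ℝ).prod 𝓘(ℝ, E)) n
        (fun p : ℝ × M => (p.1 - τ, flow X τ p.2)) (t, m₀) := by
      refine ContMDiffAt.prodMk ?_ ?_
      · exact ((contDiff_id.sub contDiff_const : ContDiff ℝ n fun s : ℝ => s - τ)
          ).contMDiff.contMDiffAt.comp (t, m₀) contMDiffAt_fst
      · exact ContMDiffAt.comp (t, m₀) (g := fun p : ℝ × M => flow X p.1 p.2)
          (f := fun p : ℝ × M => (τ, p.2)) hτS (contMDiffAt_const.prodMk contMDiffAt_snd)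
    have h2 : ContMDiffAt (𝓘(ℝ, ℝ).prod 𝓘(ℝ, E)) 𝓘(ℝ, E) n
      (fun p : ℝ × M => flow X p.1 p.2) (t - τ, flow X τ m₀) := hτ
    refine (ContMDiffAt.comp (t, m₀) (g := fun p : ℝ × M => flow X p.1 p.2)
      (f := fun p : ℝ × M => (p.1 - τ, flow X τ p.2)) h2 h1
      ).congr_of_eventuallyEq (Eventually.of_forall fun p => ?_)
    simp only [Function.comp_apply]
    rw [← flow_add hX hXc, sub_add_cancel]
  have huniv : S = univ := IsClopen.eq_univ ⟨hclosed, hopen⟩ ⟨0, h0 m₀⟩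
  exact huniv.ge (mem_univ t₀)

end LocalFlowManifold

/-! ### The circle action generated by a periodic flow -/

section Period

variable {E : Type*} [NormedAddCommGroup E] [NormedSpace ℝ E] [FiniteDimensional ℝ E]
  {M : Type*} [TopologicalSpace M] [ChartedSpace E M] [IsManifold 𝓘(ℝ, E) ∞ M] [T2Space M]
  {X : ∀ m : M, TangentSpace 𝓘(ℝ, E) m} {T : M → ℝ}

omit [FiniteDimensional ℝ E] in
/-- A period function is constant along the orbits. -/
theorem IsPeriodFunction.apply_flow (hT : IsPeriodFunction X T) (hX : IsSmoothVectorField X)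
    (hXc : IsCompleteVectorField X) (t : ℝ) (m : M) : T (flow X t m) = T m := by
  let γ : ℝ → M := fun t => flow X t m
  have hγ : Continuous γ := (isMIntegralCurve_flow hXc m).continuous
  -- The periods of the orbit form a subgroup of ℝ containing every T(γ(s)). If it is dense, the
  -- orbit is a point; if it is cyclic, T ∘ γ is a continuous map from the connected line into a
  -- discrete set.
  let G : AddSubgroup ℝ :=
    { carrier := {c | Function.Periodic γ c}
      zero_mem' := fun t => by simp
      add_mem' := fun ha hb => ha.add_period hb
      neg_mem' := fun ha => ha.neg }
  have hTG : ∀ s, T (γ s) ∈ G := fun s t => by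
    have h := hT.periodic (γ s) (t - s)
    simp only [γ, ← flow_add hX hXc] at h ⊢
    rw [sub_add_cancel, show t - s + T (flow X s m) + s = t + T (flow X s m) by ring] at h
    exact h
  have hTγ : Continuous fun s => T (γ s) := hT.smooth.continuous.comp hγ
  have h0 : γ 0 = m := flow_zero hXc m
  suffices T (γ t) = T (γ 0) by rwa [h0] at this
  rcases G.dense_or_cyclic with hd | ⟨a, ha⟩
  · have : γ = fun _ => γ 0 := hγ.ext_on hd continuous_const fun c hc => by
      simpa using hc 0
    rw [this]
  · rw [← AddSubgroup.zmultiples_eq_closure] at ha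
    refine isPreconnected_univ.constant_of_mapsTo (T := (G : Set ℝ)) ?_ hTγ.continuousOn
      (fun s _ => hTG s) (mem_univ _) (mem_univ _)
    rw [ha, isDiscrete_iff_discreteTopology]
    exact inferInstanceAs (DiscreteTopology (AddSubgroup.zmultiples a))

end Period

/-- The vector field `Υ` generates a circle action, and `ν` is a positive smooth invariant
function. -/
structure IsCircleGenerator {E : Type*} [NormedAddCommGroup E] [NormedSpace ℝ E]
    {M : Type*} [TopologicalSpace M] [ChartedSpace E M] [IsManifold 𝓘(ℝ, E) ∞ M]
    (Υ : ∀ m : M, TangentSpace 𝓘(ℝ, E) m) (ν : M → ℝ) : Prop where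
  smooth : IsSmoothVectorField Υ
  complete : IsCompleteVectorField Υ
  periodic : ∀ t m, flow Υ (t + 2 * Real.pi) m = flow Υ t m
  smooth_freq : ContMDiff 𝓘(ℝ, E) 𝓘(ℝ, ℝ) ∞ ν
  freq_pos : ∀ m, 0 < ν m
  freq_flow : ∀ t m, ν (flow Υ t m) = ν m

/-! ### From a periodic flow to a circle action -/

section Generator

variable {E : Type*} [NormedAddCommGroup E] [NormedSpace ℝ E] [FiniteDimensional ℝ E]
  {M : Type*} [TopologicalSpace M] [ChartedSpace E M] [IsManifold 𝓘(ℝ, E) ∞ M] [T2Space M]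
  {X : ∀ m : M, TangentSpace 𝓘(ℝ, E) m} {T : M → ℝ}

omit [FiniteDimensional ℝ E] [IsManifold 𝓘(ℝ, E) ∞ M] [T2Space M] in
-- Because ν is constant on the orbit, dividing X by ν merely rescales time by a constant along it.
theorem isMIntegralCurve_generator {ν : M → ℝ}
    (hXc : IsCompleteVectorField X) (hν : ∀ t m, ν (flow X t m) = ν m) (m : M) :
    IsMIntegralCurve (I := 𝓘(ℝ, E)) (fun t => flow X (t * (1 / ν m)) m) (generator X ν) := by
  intro t
  have h := (isMIntegralCurve_flow hXc m).comp_mul (1 / ν m) t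
  refine h.congr_mfderiv ?_
  simp only [Function.comp_apply, Pi.smul_apply, generator, hν]
  rfl

omit [FiniteDimensional ℝ E] in
-- The rescaling t ↦ t / ω(m) turns 2π into T(m), which gives the common period. The second
-- conclusion is the reparametrization formula underlying the comparison of 𝓛_X with 𝓛_Υ.
theorem IsPeriodFunction.isCircleGenerator (hT : IsPeriodFunction X T) (hX : IsSmoothVectorField X)
    (hXc : IsCompleteVectorField X) :
    IsCircleGenerator (generator X (frequency T)) (frequency T) ∧
      ∀ t m, flow X t m = flow (generator X (frequency T)) (frequency T m * t) m := by
  set ν := frequency T with hνdef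
  have hνpos : ∀ m, 0 < ν m := fun m => by
    have := hT.pos m
    simp only [hνdef, frequency]
    positivity
  have hνs : ContMDiff 𝓘(ℝ, E) 𝓘(ℝ, ℝ) ∞ ν := by
    have : ν = fun m => 2 * Real.pi * (T m)⁻¹ := funext fun m => div_eq_mul_inv _ _
    rw [this]
    intro m
    have h1 : ContDiffAt ℝ ∞ (fun x : ℝ => 2 * Real.pi * x⁻¹) (T m) :=
      contDiffAt_const.mul (contDiffAt_inv ℝ (hT.pos m).ne')
    exact h1.contMDiffAt.comp m (hT.smooth m)
  have hνflow : ∀ t m, ν (flow X t m) = ν m := fun t m => by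
    simp only [hνdef, frequency, hT.apply_flow hX hXc]
  have hinv : ContMDiff 𝓘(ℝ, E) 𝓘(ℝ, ℝ) ∞ fun m => 1 / ν m := fun m => by
    have h1 : ContDiffAt ℝ ∞ (fun x : ℝ => 1 / x) (ν m) :=
      contDiffAt_const.div contDiffAt_id (hνpos m).ne'
    exact h1.contMDiffAt.comp m (hνs m)
  have hcurve := isMIntegralCurve_generator hXc hνflow
  have hΥ : IsSmoothVectorField (generator X ν) := isSmoothVectorField_iff.2 fun x => by
    have h : chartField (generator X ν) x = fun m => (1 / ν m) • chartField X x m :=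
      funext fun m => (chartD (E := E) x m).map_smul (1 / ν m) (X m : E)
    rw [h]
    exact hinv.contMDiffOn.smul (isSmoothVectorField_iff.1 hX x)
  have hΥc : IsCompleteVectorField (generator X ν) := fun m =>
    ⟨_, by simp [flow_zero hXc], hcurve m⟩
  have hflow : ∀ t m, flow (generator X ν) t m = flow X (t * (1 / ν m)) m := fun t m => by
    have := flow_eq_of_isMIntegralCurve hΥ hΥc (hcurve m) t
    simpa [flow_zero hXc] using this
  refine ⟨⟨hΥ, hΥc, fun t m => ?_, hνs, hνpos, fun t m => ?_⟩, fun t m => ?_⟩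
  · rw [hflow, hflow, ← hT.periodic m (t * (1 / ν m))]
    congr 1
    have := (hT.pos m).ne'
    simp only [hνdef, frequency]
    field_simp
  · rw [hflow, hνflow]
  · rw [hflow]
    congr 1
    have := (hνpos m).ne'
    field_simp

end Generator

/-! ### The tangent maps of the flow -/

section Differential

variable {E : Type*} [NormedAddCommGroup E] [NormedSpace ℝ E]
  {M : Type*} [TopologicalSpace M] [ChartedSpace E M]

/-- The differential at `m` of a function. -/
def differential (f : M → ℝ) (m : M) : E →L[ℝ] ℝ := mfderiv 𝓘(ℝ, E) 𝓘(ℝ, ℝ) f m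

theorem IsCircleGenerator.hasMFDerivAt_freq [IsManifold 𝓘(ℝ, E) ∞ M]
    {Υ : ∀ m : M, TangentSpace 𝓘(ℝ, E) m} {ν : M → ℝ} (h : IsCircleGenerator Υ ν) (m : M) :
    HasMFDerivAt 𝓘(ℝ, E) 𝓘(ℝ, ℝ) ν m (differential (E := E) ν m) :=
  (h.smooth_freq.mdifferentiable (by simp) m).hasMFDerivAt

end Differential

section TangentFlow

variable {E : Type*} [NormedAddCommGroup E] [NormedSpace ℝ E] [FiniteDimensional ℝ E]
  {M : Type*} [TopologicalSpace M] [ChartedSpace E M] [IsManifold 𝓘(ℝ, E) ∞ M] [T2Space M]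

/-- The tangent map of the time-`t` flow at `m`. -/
def flowD (Υ : ∀ m : M, TangentSpace 𝓘(ℝ, E) m) (t : ℝ) (m : M) : E →L[ℝ] E :=
  mfderiv 𝓘(ℝ, E) 𝓘(ℝ, E) (flow Υ t) m

/-- The value of a vector field at `m` as an element of the model space. -/
def fieldVec (Υ : ∀ m : M, TangentSpace 𝓘(ℝ, E) m) (m : M) : E := Υ m

theorem hasMFDerivAt_flow {Υ : ∀ m : M, TangentSpace 𝓘(ℝ, E) m}
    (hΥ : IsSmoothVectorField Υ) (hΥc : IsCompleteVectorField Υ) (t : ℝ) (m : M) :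
    HasMFDerivAt 𝓘(ℝ, E) 𝓘(ℝ, E) (flow Υ t) m (flowD (E := E) Υ t m) :=
  (((contMDiff_flow hΥ hΥc).comp (contMDiff_const.prodMk contMDiff_id) :
    ContMDiff 𝓘(ℝ, E) 𝓘(ℝ, E) ∞ fun m => flow Υ t m).mdifferentiable (by simp) m).hasMFDerivAt

omit [FiniteDimensional ℝ E] [IsManifold 𝓘(ℝ, E) ∞ M] [T2Space M] in
theorem hasMFDerivAt_orbit {Υ : ∀ m : M, TangentSpace 𝓘(ℝ, E) m}
    (hΥc : IsCompleteVectorField Υ) (t : ℝ) (m : M) :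
    HasMFDerivAt 𝓘(ℝ, ℝ) 𝓘(ℝ, E) (fun t => flow Υ t m) t
      (ContinuousLinearMap.toSpanSingleton ℝ (fieldVec Υ (flow Υ t m)) : ℝ →L[ℝ] E) :=
  (isMIntegralCurve_flow hΥc m t).congr_mfderiv <| by
    ext
    rfl

/-- The tangent map of the flow, jointly in time and position. -/
theorem hasMFDerivAt_flow_prod {Υ : ∀ m : M, TangentSpace 𝓘(ℝ, E) m}
    (hΥ : IsSmoothVectorField Υ) (hΥc : IsCompleteVectorField Υ) (t : ℝ) (m : M) :
    HasMFDerivAt (𝓘(ℝ, ℝ).prod 𝓘(ℝ, E)) 𝓘(ℝ, E) (fun p : ℝ × M => flow Υ p.1 p.2) (t, m)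
      (((ContinuousLinearMap.toSpanSingleton ℝ (fieldVec Υ (flow Υ t m))).coprod (flowD Υ t m) :
        ℝ × E →L[ℝ] E)) := by
  have h := ((contMDiff_flow hΥ hΥc).mdifferentiable (by simp) (t, m)).hasMFDerivAt
  refine h.congr_mfderiv ?_
  let D : ℝ × E →L[ℝ] E := mfderiv (𝓘(ℝ, ℝ).prod 𝓘(ℝ, E)) 𝓘(ℝ, E)
    (fun p : ℝ × M => flow Υ p.1 p.2) (t, m)
  have h1 : HasMFDerivAt 𝓘(ℝ, ℝ) 𝓘(ℝ, E) (fun t => flow Υ t m) t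
      (D.comp ((ContinuousLinearMap.id ℝ ℝ).prod 0)) :=
    HasMFDerivAt.comp t (g := fun p : ℝ × M => flow Υ p.1 p.2) (f := fun s => (s, m)) h
      ((hasMFDerivAt_id t).prodMk (hasMFDerivAt_const m t))
  have h2 : HasMFDerivAt 𝓘(ℝ, E) 𝓘(ℝ, E) (flow Υ t) m
      (D.comp ((0 : E →L[ℝ] ℝ).prod (ContinuousLinearMap.id ℝ E))) :=
    HasMFDerivAt.comp m (g := fun p : ℝ × M => flow Υ p.1 p.2) (f := fun m => (t, m)) h
      ((hasMFDerivAt_const t m).prodMk (hasMFDerivAt_id m))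
  have h3 : D.comp ((ContinuousLinearMap.id ℝ ℝ).prod 0) =
      ContinuousLinearMap.toSpanSingleton ℝ (fieldVec Υ (flow Υ t m)) :=
    hasMFDerivAt_unique h1 (hasMFDerivAt_orbit hΥc t m)
  have h4 : D.comp ((0 : E →L[ℝ] ℝ).prod (ContinuousLinearMap.id ℝ E)) = flowD Υ t m :=
    hasMFDerivAt_unique h2 (hasMFDerivAt_flow hΥ hΥc t m)
  change D = (ContinuousLinearMap.toSpanSingleton ℝ (fieldVec Υ (flow Υ t m))).coprod (flowD Υ t m)
  rw [← h3, ← h4]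
  ext <;> simp

variable {Υ : ∀ m : M, TangentSpace 𝓘(ℝ, E) m} {ν : M → ℝ}

theorem flowD_add (hΥ : IsSmoothVectorField Υ) (hΥc : IsCompleteVectorField Υ) (s t : ℝ) (m : M) :
    flowD Υ (s + t) m = (flowD Υ s (flow Υ t m)).comp (flowD Υ t m) := by
  have h := (hasMFDerivAt_flow hΥ hΥc s (flow Υ t m)).comp m (hasMFDerivAt_flow hΥ hΥc t m)
  have e : flow Υ s ∘ flow Υ t = flow Υ (s + t) := funext fun m => (flow_add hΥ hΥc s t m).symm
  rw [e] at h
  exact hasMFDerivAt_unique (hasMFDerivAt_flow hΥ hΥc (s + t) m) h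

omit [FiniteDimensional ℝ E] [IsManifold 𝓘(ℝ, E) ∞ M] [T2Space M] in
theorem flowD_zero (hΥc : IsCompleteVectorField Υ) (m : M) :
    flowD Υ 0 m = ContinuousLinearMap.id ℝ E := by
  have e : flow Υ 0 = id := funext fun m => flow_zero hΥc m
  rw [flowD, e]
  exact mfderiv_id

omit [FiniteDimensional ℝ E] in
theorem flow_neg_flow (hΥ : IsSmoothVectorField Υ) (hΥc : IsCompleteVectorField Υ) (t : ℝ)
    (m : M) : flow Υ (-t) (flow Υ t m) = m := by
  rw [← flow_add hΥ hΥc, neg_add_cancel, flow_zero hΥc]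

theorem flowD_neg_comp (hΥ : IsSmoothVectorField Υ) (hΥc : IsCompleteVectorField Υ) (t : ℝ)
    (m : M) : (flowD Υ (-t) (flow Υ t m)).comp (flowD Υ t m) = ContinuousLinearMap.id ℝ E := by
  rw [← flowD_add hΥ hΥc, neg_add_cancel, flowD_zero hΥc]

theorem flowD_comp_neg (hΥ : IsSmoothVectorField Υ) (hΥc : IsCompleteVectorField Υ) (t : ℝ)
    (m : M) : (flowD Υ t m).comp (flowD Υ (-t) (flow Υ t m)) = ContinuousLinearMap.id ℝ E := by
  have h := flowD_add hΥ hΥc t (-t) (flow Υ t m)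
  rw [flow_neg_flow hΥ hΥc, add_neg_cancel, flowD_zero hΥc] at h
  exact h.symm

theorem flowD_inverse (hΥ : IsSmoothVectorField Υ) (hΥc : IsCompleteVectorField Υ) (t : ℝ)
    (m : M) : (flowD Υ t m).inverse = flowD Υ (-t) (flow Υ t m) :=
  ContinuousLinearMap.inverse_eq (flowD_comp_neg hΥ hΥc t m) (flowD_neg_comp hΥ hΥc t m)

theorem pullback_flow (hΥ : IsSmoothVectorField Υ) (hΥc : IsCompleteVectorField Υ) {k : ℕ}
    (A : MultivectorSection E M k) (t : ℝ) (m : M) : pullback (flow Υ t) A m =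
      Multivector.map (flowD Υ (-t) (flow Υ t m)) (A (flow Υ t m)) := by
  rw [← flowD_inverse hΥ hΥc]
  rfl

/-- Differentiate Fl^t ∘ Fl^s = Fl^s ∘ Fl^t at s = 0 along the orbit of m. -/
theorem flowD_apply_self (hΥ : IsSmoothVectorField Υ) (hΥc : IsCompleteVectorField Υ) (t : ℝ)
    (m : M) : flowD Υ t m (fieldVec Υ m) = fieldVec Υ (flow Υ t m) := by
  have h2 := hasMFDerivAt_orbit hΥc 0 (flow Υ t m)
  have h3 := (hasMFDerivAt_flow hΥ hΥc t (flow Υ 0 m)).comp 0 (hasMFDerivAt_orbit hΥc 0 m)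
  have e : flow Υ t ∘ (fun s => flow Υ s m) = fun s => flow Υ s (flow Υ t m) := funext fun s => by
    simp only [Function.comp_apply, ← flow_add hΥ hΥc, add_comm]
  rw [e] at h3
  have h4 : (flowD Υ t (flow Υ 0 m)).comp
      (ContinuousLinearMap.toSpanSingleton ℝ (fieldVec Υ (flow Υ 0 m))) =
      ContinuousLinearMap.toSpanSingleton ℝ (fieldVec Υ (flow Υ 0 (flow Υ t m))) := hasMFDerivAt_unique h3 h2
  simp only [flow_zero hΥc] at h4
  simpa using DFunLike.congr_fun h4 1

theorem IsCircleGenerator.differential_comp_flowD (h : IsCircleGenerator Υ ν) (t : ℝ) (m : M) :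
    (differential ν (flow Υ t m)).comp (flowD Υ t m) = differential (E := E) ν m := by
  have h1 := (h.hasMFDerivAt_freq (flow Υ t m)).comp m
    (hasMFDerivAt_flow h.smooth h.complete t m)
  have e : ν ∘ flow Υ t = ν := funext fun m => h.freq_flow t m
  rw [e] at h1
  exact hasMFDerivAt_unique h1 (h.hasMFDerivAt_freq m)

omit [FiniteDimensional ℝ E] [T2Space M] in
theorem IsCircleGenerator.differential_apply_self (h : IsCircleGenerator Υ ν) (m : M) :
    differential (E := E) ν m (fieldVec Υ m) = 0 := by
  have h2 := (h.hasMFDerivAt_freq (flow Υ 0 m)).comp 0 (hasMFDerivAt_orbit h.complete 0 m)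
  have e : ν ∘ (fun s => flow Υ s m) = fun _ => ν m := funext fun t => h.freq_flow t m
  rw [e] at h2
  have h4 : (differential (E := E) ν (flow Υ 0 m)).comp
      (ContinuousLinearMap.toSpanSingleton ℝ (fieldVec Υ (flow Υ 0 m))) = 0 :=
    hasMFDerivAt_unique h2 (hasMFDerivAt_const (ν m) (0 : ℝ))
  simp only [flow_zero h.complete] at h4
  simpa using DFunLike.congr_fun h4 1

/-- The tangent map of the flow of a vector field whose flow is `(t, m) ↦ Fl_Υ^{ν(m) t}(m)`. -/
theorem IsCircleGenerator.flowD_reparam (h : IsCircleGenerator Υ ν)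
    {X : ∀ m : M, TangentSpace 𝓘(ℝ, E) m} (hX : ∀ t m, flow X t m = flow Υ (ν m * t) m)
    (t : ℝ) (m : M) :
    flowD X t m = (flowD Υ (ν m * t) m).comp
      (ContinuousLinearMap.id ℝ E + t • (differential ν m).smulRight (fieldVec Υ m)) := by
  have h0 : HasMFDerivAt 𝓘(ℝ, ℝ) 𝓘(ℝ, ℝ) (fun x : ℝ => x * t) (ν m)
      (ContinuousLinearMap.toSpanSingleton ℝ t) :=
    (hasDerivAt_mul_const t).hasFDerivAt.hasMFDerivAt
  have h1 : HasMFDerivAt 𝓘(ℝ, E) 𝓘(ℝ, ℝ) (fun m => ν m * t) m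
      ((ContinuousLinearMap.toSpanSingleton ℝ t).comp (differential (E := E) ν m)) :=
    h0.comp m (h.hasMFDerivAt_freq m)
  have h2 := HasMFDerivAt.comp m (g := fun p : ℝ × M => flow Υ p.1 p.2)
    (f := fun m => (ν m * t, id m)) (hasMFDerivAt_flow_prod h.smooth h.complete (ν m * t) m)
    (h1.prodMk (hasMFDerivAt_id m))
  have e : (fun p : ℝ × M => flow Υ p.1 p.2) ∘ (fun m => (ν m * t, id m)) = flow X t :=
    funext fun m => (hX t m).symm
  rw [e] at h2
  have h3 : flowD X t m = ((ContinuousLinearMap.toSpanSingleton ℝ (fieldVec Υ (flow Υ (ν m * t) m))).coprod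
      (flowD Υ (ν m * t) m)).comp (((ContinuousLinearMap.toSpanSingleton ℝ t).comp
        (differential (E := E) ν m)).prod (ContinuousLinearMap.id ℝ E)) := h2.mfderiv
  rw [h3, ← flowD_apply_self h.smooth h.complete]
  ext v
  simp [mul_comm, add_comm, mul_smul]

/-- Since dν(Υ) = 0, the map N = t Υ ⊗ dν squares to zero, so id + N has inverse id - N, whose
action on multivectors is given by `Multivector.map_shear`. -/
theorem IsCircleGenerator.pullback_flow_reparam (h : IsCircleGenerator Υ ν)
    {X : ∀ m : M, TangentSpace 𝓘(ℝ, E) m} (hX : ∀ t m, flow X t m = flow Υ (ν m * t) m)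
    {k : ℕ} (A : MultivectorSection E M k) (t : ℝ) (m : M) :
    pullback (flow X t) A m = pullback (flow Υ (ν m * t)) A m -
      t • Multivector.wedgePred (fieldVec Υ m)
        (Multivector.interior (differential ν m) (pullback (flow Υ (ν m * t)) A m)) := by
  rw [← Multivector.map_shear]
  have h1 : (flowD X t m).inverse = (ContinuousLinearMap.id ℝ E -
      t • (differential ν m).smulRight (fieldVec Υ m)).comp (flowD Υ (ν m * t) m).inverse := by
    set s := ν m * t with hs
    set N : E →L[ℝ] E := t • (differential ν m).smulRight (fieldVec Υ m) with hN
    have hNN : ∀ v, N (N v) = 0 := fun v => by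
      simp [hN, h.differential_apply_self m]
    rw [flowD_inverse h.smooth h.complete]
    have ha := fun v => DFunLike.congr_fun (flowD_comp_neg h.smooth h.complete s m) v
    have hb := fun v => DFunLike.congr_fun (flowD_neg_comp h.smooth h.complete s m) v
    simp only [ContinuousLinearMap.comp_apply, ContinuousLinearMap.id_apply] at ha hb
    apply ContinuousLinearMap.inverse_eq <;> rw [h.flowD_reparam hX, ← hs, ← hN] <;> ext v
    · simp [hNN, ha]
    · simp [hNN, hb]
  have e : flow X t m = flow Υ (ν m * t) m := hX t m
  change Multivector.map (flowD X t m).inverse (A (flow X t m)) = _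
  rw [h1, e]
  rfl

end TangentFlow

/-! ### Smoothness of multivector fields and of their pull-backs by the flow -/

section Smooth

variable {E : Type*} [NormedAddCommGroup E] [NormedSpace ℝ E]
  {M : Type*} [TopologicalSpace M] [ChartedSpace E M]

/-- The coordinate expression of a section of `∧ᵏ TM` in the preferred chart at `x`. -/
def chartSection {k : ℕ} (A : MultivectorSection E M k) (x m : M) : Multivector E k :=
  Multivector.map (chartD x m) (A m)

theorem isSmoothMultivector_iff {k : ℕ} {A : MultivectorSection E M k} :
    IsSmoothMultivector A ↔ ∀ x : M, ContMDiffOn 𝓘(ℝ, E) 𝓘(ℝ, Multivector E k) ∞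
      (chartSection A x) (chartAt E x).source := Iff.rfl

theorem IsSmoothMultivector.add {k : ℕ} {A B : MultivectorSection E M k}
    (hA : IsSmoothMultivector A) (hB : IsSmoothMultivector B) : IsSmoothMultivector (A + B) :=
  isSmoothMultivector_iff.2 fun x =>
    ((isSmoothMultivector_iff.1 hA x).add (isSmoothMultivector_iff.1 hB x)).congr fun m _ =>
      map_add (Multivector.mapCLM (chartD (E := E) x m)) (A m) (B m)

theorem IsSmoothMultivector.smul {k : ℕ} {A : MultivectorSection E M k} {f : M → ℝ}
    (hf : ContMDiff 𝓘(ℝ, E) 𝓘(ℝ, ℝ) ∞ f) (hA : IsSmoothMultivector A) :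
    IsSmoothMultivector fun m => f m • A m :=
  isSmoothMultivector_iff.2 fun x =>
    (hf.contMDiffOn.smul (isSmoothMultivector_iff.1 hA x)).congr fun m _ =>
      map_smul (Multivector.mapCLM (chartD (E := E) x m)) (f m) (A m)

theorem IsSmoothMultivector.sub {k : ℕ} {A B : MultivectorSection E M k}
    (hA : IsSmoothMultivector A) (hB : IsSmoothMultivector B) : IsSmoothMultivector (A - B) :=
  isSmoothMultivector_iff.2 fun x =>
    ((isSmoothMultivector_iff.1 hA x).sub (isSmoothMultivector_iff.1 hB x)).congr fun m _ =>
      map_sub (Multivector.mapCLM (chartD (E := E) x m)) (A m) (B m)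

variable [IsManifold 𝓘(ℝ, E) ∞ M]

theorem hasMFDerivAt_chart {x m : M} (h : m ∈ (chartAt E x).source) :
    HasMFDerivAt 𝓘(ℝ, E) 𝓘(ℝ, E) (extChartAt 𝓘(ℝ, E) x) m (chartD (E := E) x m) :=
  (mdifferentiableAt_extChartAt h).hasMFDerivAt

theorem hasMFDerivAt_chart_symm {x m : M} (h : m ∈ (chartAt E x).source) :
    HasMFDerivAt 𝓘(ℝ, E) 𝓘(ℝ, E) (extChartAt 𝓘(ℝ, E) x).symm (extChartAt 𝓘(ℝ, E) x m)
      (chartDinv (E := E) x m) := by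
  have h1 : extChartAt 𝓘(ℝ, E) x m ∈ (extChartAt 𝓘(ℝ, E) x).target :=
    (extChartAt 𝓘(ℝ, E) x).map_source (by simpa using h)
  have := (mdifferentiableWithinAt_extChartAt_symm (I := 𝓘(ℝ, E)) h1)
  rw [modelWithCornersSelf_coe, range_id, mdifferentiableWithinAt_univ] at this
  exact this.hasMFDerivAt

/-- The coordinate expression of the differential of a smooth function is smooth. -/
theorem contMDiffOn_differential {f : M → ℝ} (hf : ContMDiff 𝓘(ℝ, E) 𝓘(ℝ, ℝ) ∞ f) (x : M) :
    ContMDiffOn 𝓘(ℝ, E) 𝓘(ℝ, E →L[ℝ] ℝ) ∞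
      (fun m => (differential (E := E) f m).comp (chartDinv x m)) (chartAt E x).source := by
  set e := extChartAt 𝓘(ℝ, E) x with he
  have h1 : ContDiffOn ℝ ∞ (f ∘ e.symm) e.target := by
    rw [← contMDiffOn_iff_contDiffOn]
    exact hf.comp_contMDiffOn (contMDiffOn_extChartAt_symm x)
  have h2 : ContDiffOn ℝ ∞ (fderiv ℝ (f ∘ e.symm)) e.target :=
    h1.fderiv_of_isOpen (isOpen_extChartAt_target x) (by simp)
  have h3 : ContMDiffOn 𝓘(ℝ, E) 𝓘(ℝ, E →L[ℝ] ℝ) ∞ (fun m => fderiv ℝ (f ∘ e.symm) (e m))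
      (chartAt E x).source :=
    (contMDiffOn_iff_contDiffOn.2 h2).comp (contMDiffOn_extChartAt (x := x))
      fun m hm => e.map_source (by simpa [he] using hm)
  refine h3.congr fun m hm => ?_
  have hm' : e.symm (e m) = m := e.left_inv (by simpa [he] using hm)
  have h4 : HasMFDerivAt 𝓘(ℝ, E) 𝓘(ℝ, ℝ) f (e.symm (e m)) (differential (E := E) f m) := by
    rw [hm']
    exact (hf.mdifferentiable (by simp) m).hasMFDerivAt
  have h5 : HasMFDerivAt 𝓘(ℝ, E) 𝓘(ℝ, ℝ) (f ∘ e.symm) (e m)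
      ((differential (E := E) f m).comp (chartDinv (E := E) x m)) :=
    h4.comp (e m) (hasMFDerivAt_chart_symm hm)
  have h6 : HasFDerivAt (f ∘ e.symm)
      ((differential (E := E) f m).comp (chartDinv (E := E) x m)) (e m) := h5.hasFDerivAt
  exact h6.fderiv.symm

theorem IsSmoothMultivector.interiorD {k : ℕ} {A : MultivectorSection E M k} {f : M → ℝ}
    (hf : ContMDiff 𝓘(ℝ, E) 𝓘(ℝ, ℝ) ∞ f) (hA : IsSmoothMultivector A) :
    IsSmoothMultivector (interiorD f A) := isSmoothMultivector_iff.2 fun x => by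
  cases k with
  | zero => exact contMDiffOn_const (c := 0)
  | succ k =>
    have h1 := (Multivector.interiorSuccCLM (V := E) k).contMDiff.comp_contMDiffOn
      (isSmoothMultivector_iff.1 hA x)
    refine (h1.clm_apply (contMDiffOn_differential hf x)).congr fun m hm => ?_
    have h2 : ((differential f m).comp (chartDinv x m)).comp (chartD x m) =
        differential (E := E) f m := by
      rw [ContinuousLinearMap.comp_assoc, chartDinv_comp_chartD hm, ContinuousLinearMap.comp_id]
    have h3 := Multivector.map_interior (chartD x m)
      ((differential f m).comp (chartDinv x m)) (A m)
    rw [h2] at h3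
    exact h3

theorem IsSmoothMultivector.wedgeX {k : ℕ} {X : ∀ m : M, TangentSpace 𝓘(ℝ, E) m}
    {D : MultivectorSection E M (k - 1)} (hX : IsSmoothVectorField X)
    (hD : IsSmoothMultivector D) : IsSmoothMultivector (k := k) (wedgeX X D) :=
  isSmoothMultivector_iff.2 fun x => by
    cases k with
    | zero => exact contMDiffOn_const (c := 0)
    | succ k =>
      have h1 := (Multivector.wedgeCLM (V := E) k).contMDiff.comp_contMDiffOn
        (isSmoothVectorField_iff.1 hX x)
      refine (h1.clm_apply (isSmoothMultivector_iff.1 hD x)).congr fun m _ => ?_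
      exact Multivector.map_wedgePred (k := k + 1) (chartD x m) (fieldVec X m) (D m)

variable [FiniteDimensional ℝ E] [T2Space M] {Υ : ∀ m : M, TangentSpace 𝓘(ℝ, E) m}

/-- The coordinate expression of the tangent maps of the flow. -/
theorem contMDiffAt_flowD_chart (hΥ : IsSmoothVectorField Υ) (hΥc : IsCompleteVectorField Υ)
    {x y m₀ : M} {t₀ : ℝ} (hy : m₀ ∈ (chartAt E y).source)
    (hx : flow Υ t₀ m₀ ∈ (chartAt E x).source) :
    ContMDiffAt (𝓘(ℝ, ℝ).prod 𝓘(ℝ, E)) 𝓘(ℝ, E →L[ℝ] E) ∞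
      (fun p : ℝ × M => ((chartD x (flow Υ p.1 p.2)).comp (flowD Υ p.1 p.2)).comp
        (chartDinv y p.2)) (t₀, m₀) := by
  set e := extChartAt 𝓘(ℝ, E) y with he
  -- The parameter q carries both the time and the base point, although G uses only the time: the
  -- base point is where the derivative in u is then evaluated.
  let G : ℝ × E → E → E := fun q u => extChartAt 𝓘(ℝ, E) x (flow Υ q.1 (e.symm u))
  have hG : ContDiffAt ℝ ∞ (Function.uncurry G) ((t₀, e m₀), e m₀) := by
    rw [← contMDiffAt_iff_contDiffAt]
    have h1 : ContMDiffAt 𝓘(ℝ, E) 𝓘(ℝ, E) ∞ e.symm (e m₀) :=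
      (contMDiffOn_extChartAt_symm y).contMDiffAt
        ((isOpen_extChartAt_target y).mem_nhds (e.map_source (by simpa [he] using hy)))
    have h2 : ContMDiffAt 𝓘(ℝ, (ℝ × E) × E) 𝓘(ℝ, E) ∞ (fun q : (ℝ × E) × E => e.symm q.2)
        ((t₀, e m₀), e m₀) :=
      ContMDiffAt.comp ((t₀, e m₀), e m₀) (g := e.symm) h1 contDiff_snd.contMDiff.contMDiffAt
    have h3 : ContMDiffAt 𝓘(ℝ, (ℝ × E) × E) 𝓘(ℝ, ℝ) ∞ (fun q : (ℝ × E) × E => q.1.1)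
        ((t₀, e m₀), e m₀) := (contDiff_fst.comp contDiff_fst).contMDiff.contMDiffAt
    have h4 : ContMDiffAt 𝓘(ℝ, (ℝ × E) × E) 𝓘(ℝ, E) ∞
        (fun q : (ℝ × E) × E => flow Υ q.1.1 (e.symm q.2)) ((t₀, e m₀), e m₀) :=
      ContMDiffAt.comp ((t₀, e m₀), e m₀) (g := fun p : ℝ × M => flow Υ p.1 p.2)
        (f := fun q : (ℝ × E) × E => (q.1.1, e.symm q.2)) (contMDiff_flow hΥ hΥc _) (h3.prodMk h2)
    refine ContMDiffAt.comp ((t₀, e m₀), e m₀) (g := extChartAt 𝓘(ℝ, E) x) ?_ h4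
    have hm : e.symm (e m₀) = m₀ := e.left_inv (by simpa [he] using hy)
    refine (contMDiffOn_extChartAt (x := x)).contMDiffAt ?_
    simp only [hm]
    exact (chartAt E x).open_source.mem_nhds hx
  have hK : ContDiffAt ℝ ∞ (fun q : ℝ × E => fderiv ℝ (G q) q.2) (t₀, e m₀) :=
    ContDiffAt.fderiv (n := ∞) hG contDiffAt_snd (by simp)
  have hq : ContMDiffAt (𝓘(ℝ, ℝ).prod 𝓘(ℝ, E)) 𝓘(ℝ, ℝ × E) ∞
      (fun p : ℝ × M => (p.1, e p.2)) (t₀, m₀) := by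
    refine ContMDiffAt.prodMk_space contMDiffAt_fst ?_
    exact ContMDiffAt.comp (t₀, m₀) (g := e) (contMDiffOn_extChartAt.contMDiffAt
      ((chartAt E y).open_source.mem_nhds hy)) contMDiffAt_snd
  have h := ContMDiffAt.comp (t₀, m₀) (g := fun q : ℝ × E => fderiv ℝ (G q) q.2)
    (f := fun p : ℝ × M => (p.1, e p.2)) hK.contMDiffAt hq
  refine h.congr_of_eventuallyEq ?_
  have hc : ∀ᶠ p in 𝓝 (t₀, m₀), flow Υ p.1 p.2 ∈ (chartAt E x).source :=
    (contMDiff_flow hΥ hΥc).continuous.continuousAt.eventually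
      ((chartAt E x).open_source.mem_nhds hx)
  have hd : ∀ᶠ p in 𝓝 (t₀, m₀), p.2 ∈ (chartAt E y).source :=
    continuousAt_snd.eventually ((chartAt E y).open_source.mem_nhds hy)
  filter_upwards [hc, hd] with p hp1 hp2
  have hm : e.symm (e p.2) = p.2 := e.left_inv (by simpa [he] using hp2)
  have h6 : HasMFDerivAt 𝓘(ℝ, E) 𝓘(ℝ, E) (extChartAt 𝓘(ℝ, E) x ∘ flow Υ p.1) (e.symm (e p.2))
      ((chartD (E := E) x (flow Υ p.1 p.2)).comp (flowD (E := E) Υ p.1 p.2)) := by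
    rw [hm]
    exact (hasMFDerivAt_chart (E := E) hp1).comp p.2 (hasMFDerivAt_flow hΥ hΥc p.1 p.2)
  have h7 : HasMFDerivAt 𝓘(ℝ, E) 𝓘(ℝ, E) (G (p.1, e p.2)) (e p.2)
      (((chartD (E := E) x (flow Υ p.1 p.2)).comp (flowD (E := E) Υ p.1 p.2)).comp
        (chartDinv (E := E) y p.2)) := h6.comp (e p.2) (hasMFDerivAt_chart_symm hp2)
  have h8 : HasFDerivAt (G (p.1, e p.2))
      (((chartD (E := E) x (flow Υ p.1 p.2)).comp (flowD (E := E) Υ p.1 p.2)).comp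
        (chartDinv (E := E) y p.2)) (e p.2) := h7.hasFDerivAt
  exact h8.fderiv.symm

/-- The pull-backs of a smooth multivector field by the flow form a smooth family. -/
theorem contMDiffOn_pullback_flow (hΥ : IsSmoothVectorField Υ) (hΥc : IsCompleteVectorField Υ)
    {k : ℕ} {A : MultivectorSection E M k} (hA : IsSmoothMultivector A) (x : M) :
    ContMDiffOn (𝓘(ℝ, ℝ).prod 𝓘(ℝ, E)) 𝓘(ℝ, Multivector E k) ∞
      (fun p : ℝ × M => chartSection (pullback (flow Υ p.1) A) x p.2)
      (univ ×ˢ (chartAt E x).source) := by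
  rintro ⟨t₀, m₀⟩ ⟨-, hm₀⟩
  refine ContMDiffAt.contMDiffWithinAt ?_
  -- A is read in a chart at the image point y, and carried back to the chart at x by the tangent
  -- map at time -t; the two chart factors at y cancel.
  let y := flow Υ t₀ m₀
  have hΦ := contMDiff_flow hΥ hΥc
  have hy : y ∈ (chartAt E y).source := mem_chart_source E y
  have hback : ContMDiffAt (𝓘(ℝ, ℝ).prod 𝓘(ℝ, E)) (𝓘(ℝ, ℝ).prod 𝓘(ℝ, E)) ∞
      (fun p : ℝ × M => (-p.1, flow Υ p.1 p.2)) (t₀, m₀) :=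
    ContMDiffAt.prodMk (contDiff_neg.contMDiff.contMDiffAt.comp (t₀, m₀) contMDiffAt_fst)
      (hΦ (t₀, m₀))
  have hL := ContMDiffAt.comp (t₀, m₀) (f := fun p : ℝ × M => (-p.1, flow Υ p.1 p.2))
    (contMDiffAt_flowD_chart hΥ hΥc (x := x) (y := y) (m₀ := y) (t₀ := -t₀) hy
      (by rw [flow_neg_flow hΥ hΥc]; exact hm₀)) hback
  have hAy : ContMDiffAt (𝓘(ℝ, ℝ).prod 𝓘(ℝ, E)) 𝓘(ℝ, Multivector E k) ∞
      (fun p : ℝ × M => chartSection A y (flow Υ p.1 p.2)) (t₀, m₀) :=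
    ContMDiffAt.comp (t₀, m₀) (g := chartSection A y) (f := fun p : ℝ × M => flow Υ p.1 p.2)
      ((isSmoothMultivector_iff.1 hA y).contMDiffAt ((chartAt E y).open_source.mem_nhds hy))
      (hΦ (t₀, m₀))
  have h := ContMDiffAt.comp (t₀, m₀)
    (g := fun p : (E →L[ℝ] E) × Multivector E k => Multivector.map p.1 p.2)
    Multivector.contDiff_map.contMDiff.contMDiffAt (hL.prodMk_space hAy)
  refine h.congr_of_eventuallyEq ?_
  have hc : ∀ᶠ p in 𝓝 (t₀, m₀), flow Υ p.1 p.2 ∈ (chartAt E y).source :=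
    hΦ.continuous.continuousAt.eventually ((chartAt E y).open_source.mem_nhds hy)
  filter_upwards [hc] with p hp
  simp only [Function.comp_apply, chartSection, Multivector.map_comp, flow_neg_flow hΥ hΥc,
    ContinuousLinearMap.comp_assoc, chartDinv_comp_chartD hp, pullback_flow hΥ hΥc,
    ContinuousLinearMap.comp_id]

/-- The pull-backs of a smooth multivector field by the flow, at a fixed point. -/
theorem contDiff_pullback_flow (hΥ : IsSmoothVectorField Υ) (hΥc : IsCompleteVectorField Υ)
    {k : ℕ} {A : MultivectorSection E M k} (hA : IsSmoothMultivector A) (m : M) :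
    ContDiff ℝ ∞ fun t => pullback (flow Υ t) A m := by
  have hm := mem_chart_source E m
  have h1 : ContMDiff 𝓘(ℝ, ℝ) 𝓘(ℝ, Multivector E k) ∞
      (fun t : ℝ => chartSection (pullback (flow Υ t) A) m m) := fun t =>
    ContMDiffAt.comp t (f := fun t : ℝ => (t, m))
      (g := fun p : ℝ × M => chartSection (pullback (flow Υ p.1) A) m p.2)
      ((contMDiffOn_pullback_flow hΥ hΥc hA m).contMDiffAt
        ((isOpen_univ.prod (chartAt E m).open_source).mem_nhds ⟨mem_univ _, hm⟩))
      (contMDiffAt_id.prodMk contMDiffAt_const)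
  have h2 := (Multivector.mapCLM (k := k) (chartDinv (E := E) m m)).contDiff.comp h1.contDiff
  have h3 : (fun t => pullback (flow Υ t) A m) = Multivector.mapCLM (chartDinv (E := E) m m) ∘
      fun t => chartSection (pullback (flow Υ t) A) m m := funext fun t => ?_
  · rw [h3]
    exact h2
  simp only [Function.comp_apply, chartSection, Multivector.mapCLM_apply, Multivector.map_comp,
    chartDinv_comp_chartD hm, Multivector.map_id]

/-- Weighted integrals of pull-backs of a smooth multivector field by the flow are smooth. -/
theorem IsSmoothMultivector.integral_pullback (hΥ : IsSmoothVectorField Υ)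
    (hΥc : IsCompleteVectorField Υ) {k : ℕ} {A : MultivectorSection E M k}
    (hA : IsSmoothMultivector A) {w : ℝ → ℝ} (hw : ContDiff ℝ ∞ w) {a b : ℝ} (hab : a ≤ b) :
    IsSmoothMultivector fun m => ∫ t in a..b, w t • pullback (flow Υ t) A m :=
  isSmoothMultivector_iff.2 fun x => by
    set e := extChartAt 𝓘(ℝ, E) x with he
    let f : E → ℝ → Multivector E k := fun u t =>
      w t • chartSection (pullback (flow Υ t) A) x (e.symm u)
    have hf : ContDiffOn ℝ ∞ (Function.uncurry f) (e.target ×ˢ univ) := by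
      refine ContDiffOn.smul (hw.comp contDiff_snd).contDiffOn ?_
      rw [← contMDiffOn_iff_contDiffOn]
      refine (contMDiffOn_pullback_flow hΥ hΥc hA x).comp
        (f := fun q : E × ℝ => (q.2, e.symm q.1)) ?_ fun q hq => ⟨mem_univ _, ?_⟩
      · exact contDiff_snd.contMDiff.contMDiffOn.prodMk
          ((contMDiffOn_extChartAt_symm x).comp contDiff_fst.contMDiff.contMDiffOn fun q hq => hq.1)
      · simpa [he] using e.map_target hq.1
    have h1 := contDiffOn_intervalIntegral (isOpen_extChartAt_target x) hf hab
    have h2 := (contMDiffOn_iff_contDiffOn.2 h1).comp (contMDiffOn_extChartAt (x := x))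
      fun m hm => e.map_source (by simpa [he] using hm)
    refine h2.congr fun m hm => ?_
    have hm' : e.symm (e m) = m := e.left_inv (by simpa [he] using hm)
    simp only [Function.comp_apply, f, ← he, hm']
    have hc : Continuous fun t => w t • pullback (flow Υ t) A m :=
      hw.continuous.smul (contDiff_pullback_flow hΥ hΥc hA m).continuous
    have h3 := (Multivector.mapCLM (k := k) (chartD (E := E) x m)).intervalIntegral_comp_comm
      (hc.intervalIntegrable (μ := volume) a b)
    simp only [map_smul] at h3
    exact h3.symm

theorem IsSmoothMultivector.average (hΥ : IsSmoothVectorField Υ) (hΥc : IsCompleteVectorField Υ)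
    {k : ℕ} {A : MultivectorSection E M k} (hA : IsSmoothMultivector A) :
    IsSmoothMultivector (average Υ A) := by
  have h := (hA.integral_pullback hΥ hΥc (w := fun _ => 1) contDiff_const
    Real.two_pi_pos.le).smul (f := fun _ => 1 / (2 * Real.pi)) contMDiff_const
  simp only [one_smul] at h
  exact h

theorem IsSmoothMultivector.opS (hΥ : IsSmoothVectorField Υ) (hΥc : IsCompleteVectorField Υ)
    {k : ℕ} {A : MultivectorSection E M k} (hA : IsSmoothMultivector A) :
    IsSmoothMultivector (opS Υ A) :=
  (hA.integral_pullback hΥ hΥc (w := fun t => t - Real.pi) (contDiff_id.sub contDiff_const)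
    Real.two_pi_pos.le).smul (f := fun _ => 1 / (2 * Real.pi)) contMDiff_const

end Smooth

namespace Multivector

variable {V : Type*} [NormedAddCommGroup V] [NormedSpace ℝ V]

/-- The interior product with a fixed covector, as a continuous linear map. -/
def interiorCLM {k : ℕ} (α : V →L[ℝ] ℝ) : Multivector V k →L[ℝ] Multivector V (k - 1) :=
  ⟨interiorL α, by
    cases k with
    | zero => exact continuous_const (y := 0)
    | succ k => exact ((interiorSuccCLM k).flip α).continuous⟩

/-- The exterior product with a fixed vector, as a continuous linear map. -/
def wedgePredCLM {k : ℕ} (v : V) : Multivector V (k - 1) →L[ℝ] Multivector V k :=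
  ⟨wedgePredL v, by
    cases k with
    | zero => exact continuous_const (y := 0)
    | succ k => exact (wedgeCLM k v).continuous⟩

end Multivector

/-! ### Periodic curves -/

section PeriodicCurve

variable {F : Type*} [NormedAddCommGroup F] [NormedSpace ℝ F]

theorem integral_comp_add_of_periodic {g : ℝ → F}
    (hp : Function.Periodic g (2 * Real.pi)) (s : ℝ) :
    ∫ t in (0 : ℝ)..(2 * Real.pi), g (s + t) = ∫ t in (0 : ℝ)..(2 * Real.pi), g t := by
  rw [intervalIntegral.integral_comp_add_left, add_zero, hp.intervalIntegral_add_eq s 0, zero_add]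

variable [CompleteSpace F]

/-- Substituting u = s + t moves s into the limits and the weight: with K a primitive of u g(u), the
integral is K(s + 2π) - K(s) - (s + π) I. By periodicity, the boundary terms differentiate to (s +
2π) g(s) - s g(s). -/
theorem hasDerivAt_integral_sub_pi_smul {g : ℝ → F} (hg : Continuous g)
    (hp : Function.Periodic g (2 * Real.pi)) (s : ℝ) :
    HasDerivAt (fun s => ∫ t in (0 : ℝ)..(2 * Real.pi), (t - Real.pi) • g (s + t))
      ((2 * Real.pi) • g s - ∫ t in (0 : ℝ)..(2 * Real.pi), g t) s := by
  set I := ∫ t in (0 : ℝ)..(2 * Real.pi), g t with hI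
  have hc : Continuous fun u : ℝ => u • g u := continuous_id.smul hg
  let K : ℝ → F := fun s => ∫ u in (0 : ℝ)..s, u • g u
  have hK : ∀ s, HasDerivAt K (s • g s) s := fun s => hc.integral_hasStrictDerivAt 0 s |>.hasDerivAt
  have e : (fun s => ∫ t in (0 : ℝ)..(2 * Real.pi), (t - Real.pi) • g (s + t)) =
      fun s => K (s + 2 * Real.pi) - K s - (s + Real.pi) • I := by
    funext s
    have h1 : ∀ t, (t - Real.pi) • g (s + t) =
        (fun u => u • g u - (s + Real.pi) • g u) (s + t) := fun t => by
      simp only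
      module
    simp only [h1]
    rw [intervalIntegral.integral_comp_add_left (fun u => u • g u - (s + Real.pi) • g u) s,
      intervalIntegral.integral_sub (hc.intervalIntegrable _ _)
        ((by fun_prop : Continuous fun u => (s + Real.pi) • g u).intervalIntegrable _ _),
      intervalIntegral.integral_smul,
      add_zero, hp.intervalIntegral_add_eq s 0, zero_add,
      intervalIntegral.integral_interval_sub_left (hc.intervalIntegrable _ _)
        (hc.intervalIntegrable _ _)]
  rw [e]
  have h1 := (((hK (s + 2 * Real.pi)).comp_add_const s (2 * Real.pi)).sub (hK s)).sub
    (((hasDerivAt_id s).add_const Real.pi).smul_const I)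
  refine h1.congr_deriv ?_
  rw [hp s]
  module

/-- After exchanging the integrals, the one over s does not depend on t by periodicity, and the
weight t - π has mean zero on [0, 2π]. -/
theorem integral_integral_sub_pi_smul {g : ℝ → F} (hg : Continuous g)
    (hp : Function.Periodic g (2 * Real.pi)) :
    ∫ s in (0 : ℝ)..(2 * Real.pi), ∫ t in (0 : ℝ)..(2 * Real.pi), (t - Real.pi) • g (s + t) = 0 := by
  have hc : Continuous (Function.uncurry fun s t : ℝ => (t - Real.pi) • g (s + t)) := by
    simp only [Function.uncurry_def]
    fun_prop
  rw [intervalIntegral_intervalIntegral_swap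
    ((hc.integrableOn_Icc (a := (0, 0)) (b := (2 * Real.pi, 2 * Real.pi))).mono_set ?_)]
  · have h1 : ∀ t, ∫ s in (0 : ℝ)..(2 * Real.pi), (t - Real.pi) • g (s + t) =
        (t - Real.pi) • ∫ s in (0 : ℝ)..(2 * Real.pi), g s := fun t => by
      simp only [add_comm _ t]
      rw [intervalIntegral.integral_smul, integral_comp_add_of_periodic hp]
    simp only [h1]
    rw [intervalIntegral.integral_smul_const, intervalIntegral.integral_sub (by simp) (by simp),
      integral_id, intervalIntegral.integral_const]
    convert zero_smul ℝ _ using 2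
    simp only [smul_eq_mul]
    ring
  · rw [uIoc_of_le Real.two_pi_pos.le, ← Icc_prod_Icc]
    exact prod_mono Ioc_subset_Icc_self Ioc_subset_Icc_self

end PeriodicCurve

/-! ### Calculus of multivector fields along a circle action -/

section Pullback

variable {E : Type*} [NormedAddCommGroup E] [NormedSpace ℝ E]
  {M : Type*} [TopologicalSpace M] [ChartedSpace E M]
  {Υ : ∀ m : M, TangentSpace 𝓘(ℝ, E) m} {k : ℕ}

theorem pullback_zero (f : M → M) : pullback f (0 : MultivectorSection E M k) = 0 :=
  funext fun _ => map_zero (Multivector.mapCLM (V := E) (W := E) _)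

theorem pullback_add (f : M → M) (A B : MultivectorSection E M k) :
    pullback f (A + B) = pullback f A + pullback f B :=
  funext fun m => map_add (Multivector.mapCLM (V := E) (W := E) _) (A (f m)) (B (f m))

theorem pullback_sub (f : M → M) (A B : MultivectorSection E M k) :
    pullback f (A - B) = pullback f A - pullback f B :=
  funext fun m => map_sub (Multivector.mapCLM (V := E) (W := E) _) (A (f m)) (B (f m))

/-- Pull-backs by the flow are linear over invariant functions. -/
theorem pullback_flow_smul (A : MultivectorSection E M k) {f : M → ℝ} {t : ℝ}
    (hf : ∀ m, f (flow Υ t m) = f m) :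
    pullback (flow Υ t) (fun m => f m • A m) = fun m => f m • pullback (flow Υ t) A m :=
  funext fun m => (map_smul (Multivector.mapCLM (V := E) (W := E) _) (f (flow Υ t m))
    (A (flow Υ t m))).trans (congrArg (· • _) (hf m))

theorem lieDerivative_eq_of_hasDerivAt {X : ∀ m : M, TangentSpace 𝓘(ℝ, E) m}
    {A : MultivectorSection E M k} {m : M} {a : Multivector E k}
    (h : HasDerivAt (fun t => pullback (flow X t) A m) a 0) : lieDerivative X A m = a := h.deriv

theorem IsCircleGenerator.pullback_periodic [IsManifold 𝓘(ℝ, E) ∞ M] {ν : M → ℝ}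
    (h : IsCircleGenerator Υ ν)
    (A : MultivectorSection E M k) (m : M) :
    Function.Periodic (fun t => pullback (flow Υ t) A m) (2 * Real.pi) := fun t => by
  have e : flow Υ (t + 2 * Real.pi) = flow Υ t := funext fun m => h.periodic t m
  simp only [e]

theorem IsInvariant.add {A B : MultivectorSection E M k} (hA : IsInvariant Υ A)
    (hB : IsInvariant Υ B) : IsInvariant Υ (A + B) := fun t => by
  rw [pullback_add, hA t, hB t]

theorem IsInvariant.sub {A B : MultivectorSection E M k} (hA : IsInvariant Υ A)
    (hB : IsInvariant Υ B) : IsInvariant Υ (A - B) := fun t => by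
  rw [pullback_sub, hA t, hB t]

theorem IsInvariant.smul {A : MultivectorSection E M k} (hA : IsInvariant Υ A) {f : M → ℝ}
    (hf : ∀ t m, f (flow Υ t m) = f m) : IsInvariant Υ fun m => f m • A m := fun t => by
  rw [pullback_flow_smul A (hf t), hA t]

end Pullback

section Calculus

variable {E : Type*} [NormedAddCommGroup E] [NormedSpace ℝ E] [FiniteDimensional ℝ E]
  {M : Type*} [TopologicalSpace M] [ChartedSpace E M] [IsManifold 𝓘(ℝ, E) ∞ M] [T2Space M]
  {Υ : ∀ m : M, TangentSpace 𝓘(ℝ, E) m} {ν : M → ℝ} {k : ℕ}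

theorem pullback_flow_zero (hΥ : IsSmoothVectorField Υ) (hΥc : IsCompleteVectorField Υ)
    (A : MultivectorSection E M k) : pullback (flow Υ 0) A = A := by
  funext m
  rw [pullback_flow hΥ hΥc, flow_zero hΥc, neg_zero, flowD_zero hΥc, Multivector.map_id]

theorem pullback_flow_add (hΥ : IsSmoothVectorField Υ) (hΥc : IsCompleteVectorField Υ)
    (A : MultivectorSection E M k) (s t : ℝ) :
    pullback (flow Υ s) (pullback (flow Υ t) A) = pullback (flow Υ (s + t)) A := by
  funext m
  have h := flowD_add hΥ hΥc (-s) (-t) (flow Υ t (flow Υ s m))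
  rw [flow_neg_flow hΥ hΥc, ← flow_add hΥ hΥc, ← neg_add, add_comm t s] at h
  simp only [pullback_flow hΥ hΥc, Multivector.map_comp, ← flow_add hΥ hΥc, add_comm t s, h]

theorem IsCircleGenerator.pullback_interiorD (h : IsCircleGenerator Υ ν)
    (A : MultivectorSection E M k) (t : ℝ) :
    pullback (flow Υ t) (interiorD ν A) = interiorD ν (pullback (flow Υ t) A) := by
  funext m
  have h1 := h.differential_comp_flowD (-t) (flow Υ t m)
  rw [flow_neg_flow h.smooth h.complete] at h1
  rw [pullback_flow h.smooth h.complete]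
  change Multivector.map _ (Multivector.interior (differential ν (flow Υ t m)) _) =
    Multivector.interior (differential ν m) (pullback (flow Υ t) A m)
  rw [← h1, Multivector.map_interior, pullback_flow h.smooth h.complete]

theorem pullback_wedgeX (hΥ : IsSmoothVectorField Υ) (hΥc : IsCompleteVectorField Υ)
    (D : MultivectorSection E M (k - 1)) (t : ℝ) :
    pullback (flow Υ t) (wedgeX (k := k) Υ D) = wedgeX Υ (pullback (flow Υ t) D) := by
  funext m
  have h1 := flowD_apply_self hΥ hΥc (-t) (flow Υ t m)
  rw [flow_neg_flow hΥ hΥc] at h1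
  rw [pullback_flow hΥ hΥc]
  change Multivector.map _ (Multivector.wedgePred (fieldVec Υ (flow Υ t m)) _) =
    Multivector.wedgePred (fieldVec Υ m) (pullback (flow Υ t) D m)
  rw [Multivector.map_wedgePred, h1, pullback_flow hΥ hΥc]

/-- The derivative of the pull-backs by the flow is the pull-back of the Lie derivative. -/
theorem hasDerivAt_pullback_flow (hΥ : IsSmoothVectorField Υ) (hΥc : IsCompleteVectorField Υ)
    {A : MultivectorSection E M k} (hA : IsSmoothMultivector A) (s : ℝ) (m : M) :
    HasDerivAt (fun t => pullback (flow Υ t) A m) (pullback (flow Υ s) (lieDerivative Υ A) m) s := by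
  have h1 : HasDerivAt (fun t => pullback (flow Υ t) A (flow Υ s m))
      (lieDerivative Υ A (flow Υ s m)) (s - s) := by
    rw [sub_self]
    exact ((contDiff_pullback_flow hΥ hΥc hA _).differentiable (by simp) 0).hasDerivAt
  have h2 := (Multivector.mapCLM (k := k) (flowD Υ (-s) (flow Υ s m))).hasFDerivAt.comp_hasDerivAt
    s (h1.comp_sub_const s s)
  rw [pullback_flow hΥ hΥc]
  refine h2.congr_of_eventuallyEq (Eventually.of_forall fun t => ?_)
  have h3 := congrFun (pullback_flow_add hΥ hΥc A s (t - s)) m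
  rw [add_sub_cancel] at h3
  simp only [← h3, pullback_flow hΥ hΥc (pullback _ A) s]
  rfl

theorem hasDerivAt_pullback_flow_zero (hΥ : IsSmoothVectorField Υ) (hΥc : IsCompleteVectorField Υ)
    {A : MultivectorSection E M k} (hA : IsSmoothMultivector A) (m : M) :
    HasDerivAt (fun t => pullback (flow Υ t) A m) (lieDerivative Υ A m) 0 := by
  simpa only [pullback_flow_zero hΥ hΥc] using hasDerivAt_pullback_flow hΥ hΥc hA 0 m

theorem isInvariant_iff_lieDerivative_eq_zero (hΥ : IsSmoothVectorField Υ)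
    (hΥc : IsCompleteVectorField Υ) {A : MultivectorSection E M k} (hA : IsSmoothMultivector A) :
    IsInvariant Υ A ↔ lieDerivative Υ A = 0 := by
  refine ⟨fun h => funext fun m => lieDerivative_eq_of_hasDerivAt ?_, fun h t => funext fun m => ?_⟩
  · simp only [h _]
    exact hasDerivAt_const _ _
  · have h1 : ∀ s, HasDerivAt (fun t => pullback (flow Υ t) A m) 0 s := fun s => by
      have := hasDerivAt_pullback_flow hΥ hΥc hA s m
      rwa [h, pullback_zero] at this
    have h2 := is_const_of_deriv_eq_zero (fun s => (h1 s).differentiableAt)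
      (fun s => (h1 s).deriv) t 0
    simpa only [pullback_flow_zero hΥ hΥc] using h2

/-- By periodicity, the Lie derivative along the generator cannot be a nonzero invariant field. -/
theorem IsCircleGenerator.isInvariant_of_lieDerivative (h : IsCircleGenerator Υ ν)
    {A : MultivectorSection E M k} (hA : IsSmoothMultivector A)
    (hi : IsInvariant Υ (lieDerivative Υ A)) : IsInvariant Υ A := by
  refine (isInvariant_iff_lieDerivative_eq_zero h.smooth h.complete hA).2 (funext fun m => ?_)
  -- The pull-back is affine in t with slope 𝓛_Υ A; comparing t = 0 with t = 2π forces the slope to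
  -- vanish.
  have h1 : ∀ s, HasDerivAt (fun t => pullback (flow Υ t) A m - t • lieDerivative Υ A m) 0 s :=
    fun s => by
      have h2 := hasDerivAt_pullback_flow h.smooth h.complete hA s m
      rw [hi s] at h2
      refine (h2.sub ((hasDerivAt_id s).smul_const (lieDerivative Υ A m))).congr_deriv ?_
      simp
  have h2 := is_const_of_deriv_eq_zero (fun s => (h1 s).differentiableAt)
    (fun s => (h1 s).deriv) (2 * Real.pi) 0
  have h3 := h.pullback_periodic A m 0
  simp only [zero_add] at h3
  simp only [h3, zero_smul, sub_zero, sub_eq_self, smul_eq_zero, Real.two_pi_pos.ne',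
    false_or] at h2
  exact h2

/-! ### The average and the operator S -/

section Integrals

variable {A : MultivectorSection E M k}

theorem intervalIntegrable_smul_pullback (hΥ : IsSmoothVectorField Υ)
    (hΥc : IsCompleteVectorField Υ) (hA : IsSmoothMultivector A) {w : ℝ → ℝ} (hw : Continuous w)
    (m : M) (a b : ℝ) :
    IntervalIntegrable (fun t => w t • pullback (flow Υ t) A m) volume a b :=
  (hw.smul (contDiff_pullback_flow hΥ hΥc hA m).continuous).intervalIntegrable a b

theorem pullback_integral (hΥ : IsSmoothVectorField Υ) (hΥc : IsCompleteVectorField Υ)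
    (hA : IsSmoothMultivector A) {w : ℝ → ℝ} (hw : Continuous w) (c a b s : ℝ) (m : M) :
    pullback (flow Υ s) (fun m => c • ∫ t in a..b, w t • pullback (flow Υ t) A m) m =
      c • ∫ t in a..b, w t • pullback (flow Υ (s + t)) A m := by
  have h1 := (Multivector.mapCLM (k := k) (flowD Υ (-s) (flow Υ s m))).intervalIntegral_comp_comm
    (intervalIntegrable_smul_pullback hΥ hΥc hA hw (flow Υ s m) a b)
  simp only [← pullback_flow_add hΥ hΥc, pullback_flow hΥ hΥc _ s]
  rw [← Multivector.mapCLM_apply, map_smul, ← h1]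
  simp only [map_smul, Multivector.mapCLM_apply]

theorem pullback_opS (hΥ : IsSmoothVectorField Υ) (hΥc : IsCompleteVectorField Υ)
    (hA : IsSmoothMultivector A) (s : ℝ) (m : M) :
    pullback (flow Υ s) (opS Υ A) m = (1 / (2 * Real.pi)) •
      ∫ t in (0 : ℝ)..(2 * Real.pi), (t - Real.pi) • pullback (flow Υ (s + t)) A m :=
  pullback_integral hΥ hΥc hA (by fun_prop) _ _ _ _ _

theorem IsCircleGenerator.isInvariant_average (h : IsCircleGenerator Υ ν)
    (hA : IsSmoothMultivector A) : IsInvariant Υ (average Υ A) := by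
  intro s
  funext m
  have h1 := pullback_integral h.smooth h.complete hA (w := fun _ => 1) continuous_const
    (1 / (2 * Real.pi)) 0 (2 * Real.pi) s m
  simp only [one_smul, integral_comp_add_of_periodic (h.pullback_periodic A m)] at h1
  exact h1

/-- Pulling back by Fl_Υ^s shifts the integrand to s + t, so this is the derivative of the weighted
periodic integral at s = 0, divided by 2π. -/
theorem IsCircleGenerator.lieDerivative_opS (h : IsCircleGenerator Υ ν)
    (hA : IsSmoothMultivector A) : lieDerivative Υ (opS Υ A) = A - average Υ A := by
  funext m
  refine lieDerivative_eq_of_hasDerivAt ?_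
  simp only [pullback_opS h.smooth h.complete hA]
  have h1 := hasDerivAt_integral_sub_pi_smul
    (contDiff_pullback_flow h.smooth h.complete hA m).continuous (h.pullback_periodic A m) 0
  refine (h1.const_smul (1 / (2 * Real.pi))).congr_deriv ?_
  rw [smul_sub, smul_smul, one_div_mul_cancel Real.two_pi_pos.ne', one_smul,
    pullback_flow_zero h.smooth h.complete]
  rfl

/-- Removes the average when 𝓛_Υ is applied to S², leaving exactly S. -/
theorem IsCircleGenerator.average_opS (h : IsCircleGenerator Υ ν)
    (hA : IsSmoothMultivector A) : average Υ (opS Υ A) = 0 := by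
  funext m
  have h1 := integral_integral_sub_pi_smul
    (contDiff_pullback_flow h.smooth h.complete hA m).continuous (h.pullback_periodic A m)
  simp only [average, pullback_opS h.smooth h.complete hA, intervalIntegral.integral_smul]
  rw [h1, smul_zero, smul_zero]
  rfl

/-- Contraction with the invariant form dν commutes with the pull-backs and, being continuous and
linear, with the integral. -/
theorem IsCircleGenerator.interiorD_opS (h : IsCircleGenerator Υ ν)
    (hA : IsSmoothMultivector A) : interiorD ν (opS Υ A) = opS Υ (interiorD ν A) := by
  funext m
  have h1 := (Multivector.interiorCLM (k := k) (differential (E := E) ν m)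
    ).intervalIntegral_comp_comm (intervalIntegrable_smul_pullback h.smooth h.complete hA
      (w := fun t => t - Real.pi) (by fun_prop) m 0 (2 * Real.pi))
  change Multivector.interiorCLM (differential (E := E) ν m) (opS Υ A m) = _
  simp only [opS, h.pullback_interiorD]
  rw [map_smul, ← h1]
  simp only [map_smul]
  rfl

end Integrals

/-! ### Lie derivatives along Υ and along X -/

section LieDerivative

variable {A B : MultivectorSection E M k}

theorem lieDerivative_add (hΥ : IsSmoothVectorField Υ) (hΥc : IsCompleteVectorField Υ)
    (hA : IsSmoothMultivector A) (hB : IsSmoothMultivector B) :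
    lieDerivative Υ (A + B) = lieDerivative Υ A + lieDerivative Υ B := funext fun m =>
  lieDerivative_eq_of_hasDerivAt (by
    simp only [pullback_add]
    exact (hasDerivAt_pullback_flow_zero hΥ hΥc hA m).add
      (hasDerivAt_pullback_flow_zero hΥ hΥc hB m))

theorem lieDerivative_smul (hΥ : IsSmoothVectorField Υ) (hΥc : IsCompleteVectorField Υ)
    (hA : IsSmoothMultivector A) {f : M → ℝ} (hf : ∀ t m, f (flow Υ t m) = f m) :
    lieDerivative Υ (fun m => f m • A m) = fun m => f m • lieDerivative Υ A m := funext fun m =>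
  lieDerivative_eq_of_hasDerivAt (by
    simp only [pullback_flow_smul A (hf _)]
    exact (hasDerivAt_pullback_flow_zero hΥ hΥc hA m).const_smul (f m))

theorem IsCircleGenerator.lieDerivative_interiorD (h : IsCircleGenerator Υ ν)
    (hA : IsSmoothMultivector A) :
    lieDerivative Υ (interiorD ν A) = interiorD ν (lieDerivative Υ A) := funext fun m =>
  lieDerivative_eq_of_hasDerivAt (by
    simp only [h.pullback_interiorD]
    exact (Multivector.interiorCLM (k := k) (differential (E := E) ν m)
      ).hasFDerivAt.comp_hasDerivAt 0 (hasDerivAt_pullback_flow_zero h.smooth h.complete hA m))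

theorem lieDerivative_wedgeX (hΥ : IsSmoothVectorField Υ) (hΥc : IsCompleteVectorField Υ)
    {D : MultivectorSection E M (k - 1)} (hD : IsSmoothMultivector D) :
    lieDerivative Υ (wedgeX (k := k) Υ D) = wedgeX Υ (lieDerivative Υ D) := funext fun m =>
  lieDerivative_eq_of_hasDerivAt (by
    simp only [pullback_wedgeX hΥ hΥc]
    exact (Multivector.wedgePredCLM (k := k) (fieldVec Υ m)
      ).hasFDerivAt.comp_hasDerivAt 0 (hasDerivAt_pullback_flow_zero hΥ hΥc hD m))

/-- The operator `A ↦ Υ ∧ i_{dν} A` at a point. -/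
def wedgeInterior (Υ : ∀ m : M, TangentSpace 𝓘(ℝ, E) m) (ν : M → ℝ) (m : M) :
    Multivector E k →L[ℝ] Multivector E k :=
  (Multivector.wedgePredCLM (k := k) (fieldVec Υ m)).comp
    (Multivector.interiorCLM (k := k) (differential (E := E) ν m))

/-- The Lie derivative along the vector field with flow `(t, m) ↦ Fl_Υ^{ν(m) t}(m)`. -/
theorem IsCircleGenerator.lieDerivative_reparam (h : IsCircleGenerator Υ ν)
    {X : ∀ m : M, TangentSpace 𝓘(ℝ, E) m} (hX : ∀ t m, flow X t m = flow Υ (ν m * t) m)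
    (hA : IsSmoothMultivector A) (m : M) :
    lieDerivative X A m = ν m • lieDerivative Υ A m -
      wedgeInterior Υ ν m (A m) := by
  refine lieDerivative_eq_of_hasDerivAt ?_
  simp only [h.pullback_flow_reparam hX]
  have h1 : HasDerivAt (fun t => pullback (flow Υ t) A m) (lieDerivative Υ A m) (ν m * 0) := by
    rw [mul_zero]
    exact hasDerivAt_pullback_flow_zero h.smooth h.complete hA m
  have h2 : HasDerivAt (fun t => pullback (flow Υ (ν m * t)) A m)
      (ν m • lieDerivative Υ A m) 0 :=
    h1.scomp 0 (by simpa using (hasDerivAt_id (0 : ℝ)).const_mul (ν m))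
  -- In t · Q(pull-back), only the derivative of the factor t survives at t = 0.
  have h3 := h2.sub ((hasDerivAt_id (0 : ℝ)).smul
    ((wedgeInterior (k := k) Υ ν m).hasFDerivAt.comp_hasDerivAt 0 h2))
  refine h3.congr_deriv ?_
  simp only [id, zero_smul, zero_add, one_smul, mul_zero, Function.comp_apply,
    pullback_flow_zero h.smooth h.complete]

end LieDerivative

end Calculus

/-! ### The homological equation -/

section HomologicalEquation

variable {E : Type*} [NormedAddCommGroup E] [NormedSpace ℝ E]
  {M : Type*} [TopologicalSpace M] [ChartedSpace E M] [IsManifold 𝓘(ℝ, E) ∞ M]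
  {Υ : ∀ m : M, TangentSpace 𝓘(ℝ, E) m} {ν : M → ℝ} {k : ℕ}

theorem IsCircleGenerator.contMDiff_one_div_pow (h : IsCircleGenerator Υ ν) (n : ℕ) :
    ContMDiff 𝓘(ℝ, E) 𝓘(ℝ, ℝ) ∞ fun m => 1 / ν m ^ n := fun m => by
  have h1 : ContDiffAt ℝ ∞ (fun x : ℝ => 1 / x ^ n) (ν m) :=
    contDiffAt_const.div (contDiffAt_id.pow n) (pow_ne_zero n (h.freq_pos m).ne')
  exact h1.contMDiffAt.comp m (h.smooth_freq m)

theorem IsCircleGenerator.contMDiff_one_div (h : IsCircleGenerator Υ ν) :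
    ContMDiff 𝓘(ℝ, E) 𝓘(ℝ, ℝ) ∞ fun m => 1 / ν m := by
  simpa only [pow_one] using h.contMDiff_one_div_pow 1

theorem IsSmoothMultivector.wedgeInterior {C : MultivectorSection E M k}
    (hC : IsSmoothMultivector C) (h : IsCircleGenerator Υ ν) :
    IsSmoothMultivector fun m => wedgeInterior Υ ν m (C m) :=
  (hC.interiorD h.smooth_freq).wedgeX h.smooth

variable [FiniteDimensional ℝ E] [T2Space M] {B : MultivectorSection E M k}

/-- A particular solution of the homological equation. -/
def particularSolution (Υ : ∀ m : M, TangentSpace 𝓘(ℝ, E) m) (ν : M → ℝ)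
    (B : MultivectorSection E M k) : MultivectorSection E M k :=
  (fun m => (1 / ν m) • opS Υ B m) +
    fun m => (1 / ν m ^ 2) • wedgeX Υ (opS Υ (opS Υ (interiorD ν B))) m

theorem IsCircleGenerator.isSmoothMultivector_particularSolution (h : IsCircleGenerator Υ ν)
    (hB : IsSmoothMultivector B) : IsSmoothMultivector (particularSolution Υ ν B) :=
  ((hB.opS h.smooth h.complete).smul h.contMDiff_one_div).add
    (((((hB.interiorD h.smooth_freq).opS h.smooth h.complete).opS h.smooth h.complete).wedgeX
      h.smooth).smul (h.contMDiff_one_div_pow 2))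


/-- Apply ν 𝓛_Υ - Q to the particular solution. The first operator gives B - ⟨B⟩ + ν⁻¹ Q S(B)
(`h1`), the second ν⁻¹ Q S(B) (`h4`), since Q annihilates the correction term. The contribution of C
is left untouched. -/
theorem IsCircleGenerator.lieDerivative_particularSolution_add (h : IsCircleGenerator Υ ν)
    {X : ∀ m : M, TangentSpace 𝓘(ℝ, E) m} (hX : ∀ t m, flow X t m = flow Υ (ν m * t) m)
    (hB : IsSmoothMultivector B) {C : MultivectorSection E M k} (hC : IsSmoothMultivector C)
    (m : M) : lieDerivative X (particularSolution Υ ν B + C) m = B m - average Υ B m +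
      (ν m • lieDerivative Υ C m - wedgeInterior Υ ν m (C m)) := by
  have hν := (h.freq_pos m).ne'
  have hi := hB.interiorD h.smooth_freq
  have hSi := hi.opS h.smooth h.complete
  have hSSi := hSi.opS h.smooth h.complete
  have hS := hB.opS h.smooth h.complete
  have h1 : lieDerivative Υ (particularSolution Υ ν B) m = (1 / ν m) • (B m - average Υ B m) +
      (1 / ν m ^ 2) • wedgeX Υ (opS Υ (interiorD ν B)) m := by
    rw [particularSolution, lieDerivative_add h.smooth h.complete (hS.smul h.contMDiff_one_div)
      ((hSSi.wedgeX h.smooth).smul (h.contMDiff_one_div_pow 2)),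
      lieDerivative_smul h.smooth h.complete hS (f := fun m => 1 / ν m)
        fun t m => by rw [h.freq_flow],
      lieDerivative_smul h.smooth h.complete (hSSi.wedgeX h.smooth) (f := fun m => 1 / ν m ^ 2)
        fun t m => by rw [h.freq_flow],
      lieDerivative_wedgeX h.smooth h.complete hSSi, h.lieDerivative_opS hB,
      h.lieDerivative_opS hSi, h.average_opS hi, sub_zero]
    rfl
  have h2 : wedgeInterior Υ ν m (opS Υ B m) = wedgeX Υ (opS Υ (interiorD ν B)) m := by
    rw [← h.interiorD_opS hB]
    rfl
  have h3 : wedgeInterior Υ ν m (wedgeX Υ (opS Υ (opS Υ (interiorD ν B))) m) = 0 :=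
    Multivector.wedgePred_interior_wedgePred (h.differential_apply_self m) _
  have h4 : wedgeInterior Υ ν m (particularSolution Υ ν B m) =
      (1 / ν m) • wedgeX Υ (opS Υ (interiorD ν B)) m := by
    simp only [particularSolution, Pi.add_apply, map_add, map_smul, h2, h3, smul_zero, add_zero]
  have hA := h.isSmoothMultivector_particularSolution hB
  rw [h.lieDerivative_reparam hX (hA.add hC), lieDerivative_add h.smooth h.complete hA hC,
    Pi.add_apply, Pi.add_apply, map_add, h1, h4]
  simp only [smul_add, smul_smul]
  rw [mul_one_div_cancel hν, one_smul, show ν m * (1 / ν m ^ 2) = 1 / ν m by field_simp]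
  abel

theorem IsCircleGenerator.isInvariant_wedgeInterior (h : IsCircleGenerator Υ ν)
    {C : MultivectorSection E M k} (hC : IsInvariant Υ C) :
    IsInvariant Υ fun m => wedgeInterior Υ ν m (C m) := fun t =>
  (pullback_wedgeX h.smooth h.complete (interiorD ν C) t).trans
    (by rw [h.pullback_interiorD, hC t]; rfl)

/-- A smooth field `C` is invariant as soon as `ν 𝓛_Υ C - Υ ∧ i_{dν} C` is. -/
theorem IsCircleGenerator.isInvariant_of_isInvariant_lieDerivative_sub
    (h : IsCircleGenerator Υ ν) {C D : MultivectorSection E M k} (hC : IsSmoothMultivector C)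
    (hD : IsInvariant Υ D)
    (hCD : ∀ m, ν m • lieDerivative Υ C m - wedgeInterior Υ ν m (C m) = D m) :
    IsInvariant Υ C := by
  have hf : ∀ t m, 1 / ν (flow Υ t m) = 1 / ν m := fun t m => by rw [h.freq_flow]
  -- Contracting the equation with dν removes the Q term and leaves ν 𝓛_Υ(i_{dν}C) = i_{dν}D, which
  -- is invariant.
  have h1 : IsInvariant Υ (interiorD ν C) := by
    refine h.isInvariant_of_lieDerivative (hC.interiorD h.smooth_freq) ?_
    have e : lieDerivative Υ (interiorD ν C) = fun m => (1 / ν m) • interiorD ν D m := by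
      rw [h.lieDerivative_interiorD hC]
      funext m
      have h2 : Multivector.interiorCLM (k := k) (differential (E := E) ν m)
          (wedgeInterior Υ ν m (C m)) = 0 :=
        Multivector.interior_wedgePred_interior (h.differential_apply_self m) (C m)
      have h3 := congrArg (Multivector.interiorCLM (k := k) (differential (E := E) ν m)) (hCD m)
      rw [map_sub, h2, sub_zero, map_smul] at h3
      change Multivector.interiorCLM (differential (E := E) ν m) (lieDerivative Υ C m) =
        (1 / ν m) • Multivector.interiorCLM (differential (E := E) ν m) (D m)
      rw [← h3, smul_smul, one_div_mul_cancel (h.freq_pos m).ne', one_smul]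
    rw [e]
    refine IsInvariant.smul (fun t => ?_) hf
    rw [h.pullback_interiorD, hD t]
  have h2 : IsInvariant Υ fun m => wedgeInterior Υ ν m (C m) := fun t =>
    (pullback_wedgeX h.smooth h.complete (interiorD ν C) t).trans (by rw [h1 t]; rfl)
  -- With Q(C) now known to be invariant, solving the equation for 𝓛_Υ C exhibits it as invariant
  -- too.
  refine h.isInvariant_of_lieDerivative hC ?_
  have e : lieDerivative Υ C =
      fun m => (1 / ν m) • (D + fun m => wedgeInterior Υ ν m (C m)) m := by
    funext m
    rw [Pi.add_apply, ← hCD m, sub_add_cancel, smul_smul, one_div_mul_cancel (h.freq_pos m).ne',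
      one_smul]
  rw [e]
  exact (hD.add h2).smul hf

/-- The solutions of the homological equation. -/
theorem IsCircleGenerator.homological_equation_iff (h : IsCircleGenerator Υ ν)
    {X : ∀ m : M, TangentSpace 𝓘(ℝ, E) m} (hX : ∀ t m, flow X t m = flow Υ (ν m * t) m)
    (hB : IsSmoothMultivector B) (A Bbar : MultivectorSection E M k) :
    (IsSmoothMultivector A ∧ IsSmoothMultivector Bbar ∧ lieDerivative X A = B - Bbar ∧
      IsInvariant Υ Bbar) ↔
    ∃ C : MultivectorSection E M k, IsSmoothMultivector C ∧ IsInvariant Υ C ∧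
      (∀ m, Bbar m = average Υ B m + wedgeInterior Υ ν m (C m)) ∧
      (∀ m, A m = particularSolution Υ ν B m + C m) := by
  have hA₀ := h.isSmoothMultivector_particularSolution hB
  have hBa := hB.average h.smooth h.complete
  have hBi := h.isInvariant_average hB
  constructor
  · rintro ⟨hA, -, hlie, hinv⟩
    have hC := hA.sub hA₀
    have hCD : ∀ m, ν m • lieDerivative Υ (A - particularSolution Υ ν B) m -
        wedgeInterior Υ ν m ((A - particularSolution Υ ν B) m) = (average Υ B - Bbar) m := by
      intro m
      have h1 := h.lieDerivative_particularSolution_add hX hB hC m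
      rw [add_sub_cancel, hlie, Pi.sub_apply] at h1
      rw [← sub_eq_iff_eq_add'.2 h1, Pi.sub_apply]
      abel
    have hCi := h.isInvariant_of_isInvariant_lieDerivative_sub hC (hBi.sub hinv) hCD
    refine ⟨_, hC, hCi, fun m => ?_, fun m =>
      (add_sub_cancel (particularSolution Υ ν B m) (A m)).symm⟩
    -- Invariance gives 𝓛_Υ C = 0, so the equation collapses to -Q(C) = ⟨B⟩ - B̄.
    have h2 := hCD m
    rw [(isInvariant_iff_lieDerivative_eq_zero h.smooth h.complete hC).1 hCi, Pi.zero_apply,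
      smul_zero, zero_sub, neg_eq_iff_eq_neg] at h2
    rw [h2, Pi.sub_apply]
    abel
  · rintro ⟨C, hC, hCi, hBbar, hAC⟩
    obtain rfl : A = particularSolution Υ ν B + C := funext hAC
    obtain rfl : Bbar = average Υ B + fun m => wedgeInterior Υ ν m (C m) := funext hBbar
    refine ⟨hA₀.add hC, hBa.add (hC.wedgeInterior h), funext fun m => ?_,
      hBi.add (h.isInvariant_wedgeInterior hCi)⟩
    rw [h.lieDerivative_particularSolution_add hX hB hC,
      (isInvariant_iff_lieDerivative_eq_zero h.smooth h.complete hC).1 hCi]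
    simp only [Pi.zero_apply, smul_zero, Pi.sub_apply, Pi.add_apply]
    abel

end HomologicalEquation

end PeriodicFlow

end

/-! ### The theorem in terms of X and ω -/

theorem theorem3p1 {E : Type*} [NormedAddCommGroup E] [NormedSpace ℝ E] [FiniteDimensional ℝ E]
    {M : Type*} [TopologicalSpace M] [T2Space M] [ChartedSpace E M] [IsManifold 𝓘(ℝ, E) ∞ M]
    (X : ∀ m : M, TangentSpace 𝓘(ℝ, E) m)
    (hX : PeriodicFlow.IsSmoothVectorField X) (hXc : PeriodicFlow.IsCompleteVectorField X)
    (T : M → ℝ) (hT : PeriodicFlow.IsPeriodFunction X T)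
    (freq : M → ℝ) (hfreq : freq = PeriodicFlow.frequency T)
    (Υ : ∀ m : M, TangentSpace 𝓘(ℝ, E) m) (hΥ : Υ = PeriodicFlow.generator X freq)
    (k : ℕ) (B : PeriodicFlow.MultivectorSection E M k)
    (hB : PeriodicFlow.IsSmoothMultivector B)
    (A Bbar : PeriodicFlow.MultivectorSection E M k) :
    (PeriodicFlow.IsSmoothMultivector A ∧ PeriodicFlow.IsSmoothMultivector Bbar ∧
      PeriodicFlow.lieDerivative X A = B - Bbar ∧ PeriodicFlow.IsInvariant Υ Bbar) ↔
    ∃ C : PeriodicFlow.MultivectorSection E M k,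
      PeriodicFlow.IsSmoothMultivector C ∧ PeriodicFlow.IsInvariant Υ C ∧
      (∀ m, Bbar m = PeriodicFlow.average Υ B m +
        (1 / freq m) • PeriodicFlow.wedgeX X (PeriodicFlow.interiorD freq C) m) ∧
      (∀ m, A m = (1 / freq m) • PeriodicFlow.opS Υ B m +
        (1 / freq m ^ 3) • PeriodicFlow.wedgeX X
          (PeriodicFlow.opS Υ (PeriodicFlow.opS Υ (PeriodicFlow.interiorD freq B))) m + C m) := by
  obtain ⟨h, hflow⟩ := hT.isCircleGenerator hX hXc
  rw [← hfreq, ← hΥ] at h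
  rw [← hfreq, ← hΥ] at hflow
  rw [h.homological_equation_iff hflow hB A Bbar]
  have hw : ∀ (D : PeriodicFlow.MultivectorSection E M (k - 1)) m,
      PeriodicFlow.wedgeX (k := k) Υ D m = (1 / freq m) • PeriodicFlow.wedgeX X D m := fun D m => by
    subst hΥ
    exact PeriodicFlow.Multivector.smul_wedgePred (1 / freq m) (PeriodicFlow.fieldVec X m) (D m)
  have hQ : ∀ (C : PeriodicFlow.MultivectorSection E M k) m,
      PeriodicFlow.wedgeInterior Υ freq m (C m) =
        (1 / freq m) • PeriodicFlow.wedgeX X (PeriodicFlow.interiorD freq C) m :=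
    fun C m => hw (PeriodicFlow.interiorD freq C) m
  -- Replacing Υ by ω⁻¹ X in the wedge product turns the coefficient ω⁻² into ω⁻³.
  have hP : ∀ m, PeriodicFlow.particularSolution Υ freq B m =
      (1 / freq m) • PeriodicFlow.opS Υ B m + (1 / freq m ^ 3) • PeriodicFlow.wedgeX X
          (PeriodicFlow.opS Υ (PeriodicFlow.opS Υ (PeriodicFlow.interiorD freq B))) m := fun m => by
    change (1 / freq m) • PeriodicFlow.opS Υ B m + (1 / freq m ^ 2) • PeriodicFlow.wedgeX Υ
      (PeriodicFlow.opS Υ (PeriodicFlow.opS Υ (PeriodicFlow.interiorD freq B))) m = _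
    rw [hw, smul_smul, one_div_mul_one_div, ← pow_succ]
  simp only [hQ, hP]
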